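/- **Setting.** Let $O\subset\mathbb{R}^2$ be an open (bounded) convex polygon with $n\ge 3$ vertices, $F=\mathbb{R}^2\setminus O$. Points $x,y\in F$ are visible from each other iff $\overline{xy}\cap O=\emptyset$; for $S\subseteq F$ let $V(S)=\{x\in F:\exists y\in S,\ \overline{xy}\cap O=\emptyset\}$. A path is a continuous map $[0,1]\to F$; it is a watchman route if $V$ of its image is $F$. An edge of $O$ is seen when all of it is visible from one visited point. **Scope.** As long as not all edges have been seen, let $v^R_{ext}$ (resp. $v^L_{ext}$) be the counterclockwise (resp. clockwise) end vertex of the chain of edges seen so far, $LOS_R$ (resp. $LOS_L$) the line of sight turned furthest counterclockwise (resp. clockwise) among those from visited points that see the last edge of the chain to this vertex, $m=\overline{v^R_{ext}v^L_{ext}}$, and let the *scope* $\psi\in(-\pi,\pi]$ be the counterclockwise angle from the direction of $LOS_R$ to that of $LOS_L$. It is *opening* if $\psi\ge0$ and *closing* if $\psi<0$; then the lines of sight meet behind $O$ in an angle $|\psi|$. The exploration is *finished* when the chain of seen edges has closed up around $O$ (so that a vertex has been listed from both sides). **Spiral search** with first length $Q$ on a (broken) line through the current position: walk legs of lengths $Q,2Q,4Q,\dots$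 in alternating directions, the first one towards the closer of the two projections of $v^R_{ext},v^L_{ext}$ to the line; $Q$ is the length of the projection of $m$ to the line. **Algorithm ONPA**, from a starting point $s\in F$: 1. If $\psi>\pi/2$: spiral search on the line through $s$ parallel to $m$, until the first moment at which the exploration is finished or $\psi\le\pi/2$. If it is finished, stop; if the scope is closing, go to 3; otherwise return straight to $s$ and go to 2. 2. If $0\le\psi\le\pi/2$: spiral search on the line through $s$ perpendicular to the bisector of the scope, until the first moment at which the exploration is finished or the scope is closing with $|\psi|\ge\pi/8$. If this line runs into $O$, it is replaced by the broken line that goes around $O$ along its boundary (on either side), with lengths measured along it. If finished, stop; otherwise go to 3. 3. While not finished: update $m$, and walk straight from the current position $p$ to the foot of the perpendicular on the line of $m$, if this foot does not lie in the interior of the segment $m$ and is visible from $p$. Otherwise $O$ is in the way: choose one of the two directions around $O$, that is, one of the two closed rays of the line of $m$ outside $m$, that contains a point visible from $p$, and walk straight to the closest visible point of that ray. **Theorem (Correctness).** For every convex polygon $O$ and every starting point $s\in F$, every execution of ONPA (however ties and the choices left open above are resolved) stops after finitely many moves, without getting stuck. Its path starts in $s$, has finite length, stays in $F$, and explores $\mathbb{R}^2\setminus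 O$ entirely: every $p\in F$ is visible from some point of the path. Thus it is a watchman route. -/

import Mathlib

open Set

noncomputable section

namespace ONPA

/-! The Euclidean plane `ℝ²` is modelled by `ℂ` (same norm, same real inner product). -/

/-- The planar cross product; it is positive when `b` points to the left of `a`. -/
def cross (a b : ℂ) : ℝ := a.re * b.im - a.im * b.re

/-- A convex polygon, given by its `n ≥ 3` vertices in counterclockwise order: every vertex that
is not an endpoint of an edge lies strictly to the left of this (directed) edge. -/
structure ConvexPolygon where
  n : ℕ
  three_le : 3 ≤ n
  vertex : ZMod n → ℂ
  convex : ∀ i k : ZMod n, k ≠ i → k ≠ i + 1 →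
    0 < cross (vertex (i + 1) - vertex i) (vertex k - vertex i)

namespace ConvexPolygon

variable (K : ConvexPolygon)

/-- The obstacle `O`: the open convex polygon. -/
def obstacle : Set ℂ := interior (convexHull ℝ (range K.vertex))

/-- The free space `F = ℝ² ∖ O`. -/
def free : Set ℂ := K.obstacleᶜ

/-- Two points are visible from each other iff the straight segment between them misses `O`. -/
def Visible (x y : ℂ) : Prop := segment ℝ x y ∩ K.obstacle = ∅

/-- The visible set `V(S)` of a set `S`. -/
def visibleSet (S : Set ℂ) : Set ℂ := {x | x ∈ K.free ∧ ∃ y ∈ S, K.Visible x y}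

/-- A path: a continuous map from `[0,1]` to the free space. -/
def IsPath (f : ℝ → ℂ) : Prop := ContinuousOn f (Icc 0 1) ∧ MapsTo f (Icc 0 1) K.free

/-- A watchman route: a path from which all of the free space is visible. -/
def IsWatchmanRoute (f : ℝ → ℂ) : Prop :=
  K.IsPath f ∧ K.visibleSet (f '' Icc 0 1) = K.free

/-! ### What the robot has seen -/

/-- The edge from vertex `i` to vertex `i + 1` is visible (entirely) from `x`. -/
def SeesEdge (x : ℂ) (i : ZMod K.n) : Prop :=
  ∀ y ∈ segment ℝ (K.vertex i) (K.vertex (i + 1)), K.Visible x y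

/-- The edge `i` has been seen by a robot that has visited the points of `P`. -/
def EdgeSeen (P : Set ℂ) (i : ZMod K.n) : Prop := ∃ x ∈ P, K.SeesEdge x i

/-- The chain of seen edges has closed up around the polygon: its clockwise end and its
counterclockwise end are the same vertex, which is then listed twice. -/
def Finished (P : Set ℂ) : Prop := ∀ i, K.EdgeSeen P i

/-- The data of a scope: the extreme vertices `R` (counterclockwise) and `L` (clockwise), and the
points `pR`, `pL` from which they have been seen extremely. -/
structure Scope where
  R : ZMod K.n
  L : ZMod K.n
  pR : ℂ
  pL : ℂ

namespace Scope

variable {K}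
variable (σ : K.Scope)

/-- The right extreme vertex. -/
def vR : ℂ := K.vertex σ.R

/-- The left extreme vertex. -/
def vL : ℂ := K.vertex σ.L

/-- The direction of the right extreme line of sight. -/
def uR : ℂ := σ.vR - σ.pR

/-- The direction of the left extreme line of sight. -/
def uL : ℂ := σ.vL - σ.pL

/-- The signed scope: the counterclockwise angle, in `(-π, π]`, from the right to the left extreme
line of sight. It is the angle of an opening scope when it is nonnegative (the two lines of sight
diverge or are parallel, and the unobserved region is unbounded); when it is negative the lines
of sight meet behind the obstacle, the scope is closing, and the triangle they form has there the
angle `-σ.angle`. -/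
def angle : ℝ := Complex.arg (σ.uL / σ.uR)

end Scope

/-- `σ` is the scope of a robot that has visited exactly the points of `P`. Edge `R - 1` is the
last seen edge counterclockwise, edge `L` the last seen edge clockwise; among the points of `P`
that see this edge, `pR` (resp. `pL`) is one whose line of sight to the extreme vertex is turned
furthest counterclockwise (resp. clockwise). -/
structure IsScope (P : Set ℂ) (σ : K.Scope) : Prop where
  seenR : K.EdgeSeen P (σ.R - 1)
  unseenR : ¬ K.EdgeSeen P σ.R
  seenL : K.EdgeSeen P σ.L
  unseenL : ¬ K.EdgeSeen P (σ.L - 1)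
  memR : σ.pR ∈ P
  seesR : K.SeesEdge σ.pR (σ.R - 1)
  extremeR : ∀ q ∈ P, K.SeesEdge q (σ.R - 1) → 0 ≤ cross (σ.vR - q) σ.uR
  memL : σ.pL ∈ P
  seesL : K.SeesEdge σ.pL σ.L
  extremeL : ∀ q ∈ P, K.SeesEdge q σ.L → cross (σ.vL - q) σ.uL ≤ 0

/-! ### Spiral search on a line -/

end ConvexPolygon

/-- Position, after travelling the distance `t`, of a one-dimensional spiral search from `0`: legs
of length `Q, 2Q, 4Q, …` in alternating directions, the first one in the positive direction. Leg
number `k = 0, 1, …` starts after the distance `(2 ^ k - 1) Q`, at position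
`(1 - (-2) ^ k) Q / 3`. -/
def zigzag (Q t : ℝ) : ℝ :=
  let k := Nat.log 2 ⌊t / Q + 1⌋₊
  (1 - (-2) ^ k) * Q / 3 + (-1) ^ k * (t - (2 ^ k - 1) * Q)

namespace ConvexPolygon

variable (K : ConvexPolygon)

/-- The unit vector `w` points from `p` towards the closer one of the projections of the two
extreme vertices to the line `p + ℝ w` (either one in case of a tie). -/
def TowardsCloser (σ : K.Scope) (p w : ℂ) : Prop :=
  (0 ≤ inner ℝ w (σ.vR - p) ∧ |inner ℝ w (σ.vR - p)| ≤ |inner ℝ w (σ.vL - p)|) ∨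
  (0 ≤ inner ℝ w (σ.vL - p) ∧ |inner ℝ w (σ.vL - p)| ≤ |inner ℝ w (σ.vR - p)|)

/-- `β` is the line `p + ℝ w`, or, if this line runs into the obstacle, a broken line, parametrized
by arc length, which is obtained from the line by walking around the obstacle along its boundary
(on either side). -/
structure IsBrokenLine (p w : ℂ) (β : ℝ → ℂ) : Prop where
  start : β 0 = p
  straight : (∀ t : ℝ, p + t • w ∉ K.obstacle) → ∀ t : ℝ, β t = p + t • w
  mem_free : ∀ t, β t ∈ K.free
  mem_line_or_frontier : ∀ t, (∃ r : ℝ, β t = p + r • w) ∨ β t ∈ frontier K.obstacle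
  unitSpeed : HasUnitSpeedOn β univ
  injective : Function.Injective β
  atTop : Filter.Tendsto (fun t => inner ℝ w (β t)) Filter.atTop Filter.atTop
  atBot : Filter.Tendsto (fun t => inner ℝ w (β t)) Filter.atBot Filter.atBot

end ConvexPolygon

/-- The ray on the line through `a` and `b` that starts in `a` and points away from `b`. -/
def outerRay (a b : ℂ) : Set ℂ := {q | ∃ t : ℝ, 0 ≤ t ∧ q = a + t • (a - b)}

/-! ### Executions of the algorithm -/

/-- The phases of the algorithm: deciding on a search while the scope is opening, the spiral search
parallel to the segment of the extreme vertices (direction `w`, first leg `Q`), the spiral search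
perpendicular to the bisector of the scope (on the broken line `β`, first leg `Q`), and the approach
of the far side. -/
inductive Phase where
  | opening
  | parallel (w : ℂ) (Q : ℝ)
  | bisection (β : ℝ → ℂ) (Q : ℝ)
  | closing

/-- A state: the path walked so far is `path` on `[0, time]`. -/
structure State where
  time : ℝ
  path : ℝ → ℂ
  phase : Phase

namespace State

/-- The initial state at the starting point `s`. -/
def init (s : ℂ) : State := ⟨0, fun _ => s, Phase.opening⟩

variable (X : State)

/-- The current position. -/
def pos : ℂ := X.path X.time

/-- The points visited so far. -/
def visited : Set ℂ := X.path '' Icc 0 X.time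

/-- The path walked so far, parametrized by `[0,1]`. -/
def route (u : ℝ) : ℂ := X.path (u * X.time)

/-- Append the motion `g` on `[0, τ]`, and go to phase `ph`. -/
def move (g : ℝ → ℂ) (τ : ℝ) (ph : Phase) : State :=
  ⟨X.time + τ, fun t => if t ≤ X.time then X.path t else g (t - X.time), ph⟩

/-- Walk straight, with unit speed, to the point `q`, and go to phase `ph`. -/
def walkTo (q : ℂ) (ph : Phase) : State :=
  X.move (fun t => X.pos + (t / ‖q - X.pos‖) • (q - X.pos)) ‖q - X.pos‖ ph

end State

namespace ConvexPolygon

variable (K : ConvexPolygon)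

/-- Starting in state `X`, the motion `g` satisfies the condition `C` on the set of all visited
points for the first time after time `τ`. -/
def FirstTime (C : Set ℂ → Prop) (X : State) (g : ℝ → ℂ) (τ : ℝ) : Prop :=
  IsLeast {r : ℝ | 0 ≤ r ∧ C (X.move g r X.phase).visited} τ

/-- The parallel search stops when it is finished or the scope is at most `π / 2`. -/
def ParallelStop (P : Set ℂ) : Prop :=
  K.Finished P ∨ ∃ σ, K.IsScope P σ ∧ σ.angle ≤ Real.pi / 2

/-- The search perpendicular to the bisector stops when it is finished or the scope is closing with
a triangle of angle `π / 8`. -/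
def BisectionStop (P : Set ℂ) : Prop :=
  K.Finished P ∨ ∃ σ, K.IsScope P σ ∧ σ.angle ≤ -(Real.pi / 8)

/-- The point `q`, on the line of the segment `m` between the extreme vertices but not inside `m`
(which belongs to the closed polygon), is the foot of the perpendicular from `p`, and `O` is not in
the way. -/
def IsFreeFoot (σ : K.Scope) (p q : ℂ) : Prop :=
  (q ∈ outerRay σ.vR σ.vL ∨ q ∈ outerRay σ.vL σ.vR) ∧
    inner ℝ (q - p) (σ.vL - σ.vR) = 0 ∧ K.Visible p q

/-- `q` is the point of `A` closest to `p` among those that are reached from `p` without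
intersecting `O`. -/
def IsClosestFree (A : Set ℂ) (p q : ℂ) : Prop :=
  q ∈ A ∧ K.Visible p q ∧ ∀ q' ∈ A, K.Visible p q' → dist p q ≤ dist p q'

/-- The goal `q` of the next move from `p` towards the segment `m` between the extreme vertices:
perpendicularly to the line of `m` if `O` is not in the way, and otherwise to the closest point of
this line, in one of the two directions around the polygon, that can be reached directly. -/
def IsClosingTarget (σ : K.Scope) (p q : ℂ) : Prop :=
  K.IsFreeFoot σ p q ∨
  ((∀ q', ¬ K.IsFreeFoot σ p q') ∧
    (K.IsClosestFree (outerRay σ.vR σ.vL) p q ∨ K.IsClosestFree (outerRay σ.vL σ.vR) p q))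

/-- One step of the online path algorithm. -/
inductive Step : State → State → Prop
  /-- Opening scope larger than `π / 2`: start a spiral search parallel to the segment `m` between
  the extreme vertices. -/
  | chooseParallel (X : State) (σ : K.Scope) (w : ℂ)
      (hX : X.phase = Phase.opening) (hσ : K.IsScope X.visited σ)
      (hangle : Real.pi / 2 < σ.angle)
      (hw : ‖w‖ = 1) (hpar : cross w (σ.vL - σ.vR) = 0) (hdir : K.TowardsCloser σ X.pos w) :
      Step X { X with phase := Phase.parallel w |inner ℝ w (σ.vL - σ.vR)| }
  /-- The parallel search ends with an opening scope: return to the starting point. -/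
  | parallelReturn (X : State) (w : ℂ) (Q τ : ℝ) (σ : K.Scope)
      (hX : X.phase = Phase.parallel w Q)
      (hτ : FirstTime K.ParallelStop X (fun t => X.pos + zigzag Q t • w) τ)
      (hσ : K.IsScope (X.move (fun t => X.pos + zigzag Q t • w) τ Phase.opening).visited σ)
      (hangle : 0 ≤ σ.angle) :
      Step X ((X.move (fun t => X.pos + zigzag Q t • w) τ Phase.opening).walkTo
        (X.path 0) Phase.opening)
  /-- The parallel search has finished the exploration, or ends with a closing scope. -/
  | parallelClose (X : State) (w : ℂ) (Q τ : ℝ)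
      (hX : X.phase = Phase.parallel w Q)
      (hτ : FirstTime K.ParallelStop X (fun t => X.pos + zigzag Q t • w) τ)
      (hclose : K.Finished (X.move (fun t => X.pos + zigzag Q t • w) τ Phase.closing).visited ∨
        ∃ σ, K.IsScope (X.move (fun t => X.pos + zigzag Q t • w) τ Phase.closing).visited σ ∧
          σ.angle < 0) :
      Step X (X.move (fun t => X.pos + zigzag Q t • w) τ Phase.closing)
  /-- Opening scope of at most `π / 2`: start a spiral search perpendicular to the bisector of the
  scope, with the length of the projection of `m` as length of the first leg. -/
  | chooseBisection (X : State) (σ : K.Scope) (w : ℂ) (β : ℝ → ℂ)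
      (hX : X.phase = Phase.opening) (hσ : K.IsScope X.visited σ)
      (hangle₀ : 0 ≤ σ.angle) (hangle : σ.angle ≤ Real.pi / 2)
      (hw : ‖w‖ = 1) (hperp : inner ℝ w (‖σ.uR‖⁻¹ • σ.uR + ‖σ.uL‖⁻¹ • σ.uL) = 0)
      (hdir : K.TowardsCloser σ X.pos w) (hβ : K.IsBrokenLine X.pos w β) :
      Step X { X with phase := Phase.bisection β |inner ℝ w (σ.vL - σ.vR)| }
  /-- The search perpendicular to the bisector ends. -/
  | bisectionClose (X : State) (β : ℝ → ℂ) (Q τ : ℝ)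
      (hX : X.phase = Phase.bisection β Q)
      (hτ : FirstTime K.BisectionStop X (fun t => β (zigzag Q t)) τ) :
      Step X (X.move (fun t => β (zigzag Q t)) τ Phase.closing)
  /-- While not finished: move towards the segment `m` between the current extreme vertices. -/
  | approach (X : State) (σ : K.Scope) (q : ℂ)
      (hX : X.phase = Phase.closing) (hfin : ¬ K.Finished X.visited)
      (hσ : K.IsScope X.visited σ) (hq : K.IsClosingTarget σ X.pos q) :
      Step X (X.walkTo q Phase.closing)

/-- `X` is reached by an execution of the algorithm from the starting point `s`. -/
def Reaches (s : ℂ) (X : State) : Prop := Relation.ReflTransGen K.Step (State.init s) X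

/-- The execution stops in `X`. -/
def Halted (X : State) : Prop := ∀ Y, ¬ K.Step X Y

end ConvexPolygon

end ONPA

end

/-!
An edge is seen from a point exactly when the point is on the outer side of its line. As the visited
set is connected, its extreme lines of sight exist and their angle, the scope, depends only on this
set. Far out on both sides along any line, all edges are seen except at most one, parallel to the
line, and in this case the scope is at most `-π / 2`. Hence each spiral search stops, and as its
stopping condition is closed, there is a first such moment. At this moment, and after each approach
move, the robot is not inside an edge unless it has finished, so it can see some point of the line
of `m` outside `m`; this point is on the outer side of an edge not seen before. Thus there are at
most `n` approach moves. Once all edges are seen, every free point is visible from some visited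
point.
-/

namespace ONPA

open Filter Topology

/-! ### Edges and lines of sight of a convex polygon -/

section Cross

variable (a b c : ℂ)

@[simp] theorem cross_self : cross a a = 0 := by simp [cross, mul_comm]

@[simp] theorem cross_zero_left : cross 0 b = 0 := by simp [cross]

theorem cross_swap : cross a b = -cross b a := by simp only [cross]; ring

@[simp] theorem cross_neg_left : cross (-a) b = -cross a b := by
  simp only [cross, Complex.neg_re, Complex.neg_im]; ring

@[simp] theorem cross_neg_right : cross a (-b) = -cross a b := by
  simp only [cross, Complex.neg_re, Complex.neg_im]; ring

theorem cross_add_right : cross a (b + c) = cross a b + cross a c := by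
  simp only [cross, Complex.add_re, Complex.add_im]; ring

theorem cross_sub_right : cross a (b - c) = cross a b - cross a c := by
  simp only [cross, Complex.sub_re, Complex.sub_im]; ring

@[simp] theorem cross_smul_left (t : ℝ) : cross (t • a) b = t * cross a b := by
  simp only [cross, Complex.smul_re, Complex.smul_im, smul_eq_mul]; ring

@[simp] theorem cross_smul_right (t : ℝ) : cross a (t • b) = t * cross a b := by
  simp only [cross, Complex.smul_re, Complex.smul_im, smul_eq_mul]; ring

theorem cross_mul_I : cross a (Complex.I * a) = ‖a‖ ^ 2 := by
  rw [← Complex.normSq_eq_norm_sq, Complex.normSq_apply]; simp [cross]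

theorem sum_cross_left {ι : Type*} (s : Finset ι) (f : ι → ℂ) :
    ∑ i ∈ s, cross (f i) b = cross (∑ i ∈ s, f i) b := by
  simp only [cross, Complex.re_sum, Complex.im_sum, Finset.sum_mul, Finset.sum_sub_distrib]

theorem continuous_cross {X : Type*} [TopologicalSpace X] {f g : X → ℂ} (hf : Continuous f)
    (hg : Continuous g) : Continuous fun x => cross (f x) (g x) := by
  unfold cross; fun_prop

end Cross

/-- Twice the signed area of the triangle `a b x`, as an affine function of `x`: it is positive to
the left of the directed line from `a` to `b`, and vanishes on it. -/
def signedArea (a b : ℂ) : ℂ →ᵃ[ℝ] ℝ where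
  toFun x := cross (b - a) (x - a)
  linear := (b - a).re • Complex.imLm - (b - a).im • Complex.reLm
  map_vadd' x v := by simp [cross]; ring

section SignedArea

variable (a b c x y : ℂ)

theorem signedArea_apply : signedArea a b x = cross (b - a) (x - a) := rfl

@[simp] theorem signedArea_left : signedArea a b a = 0 := by simp [signedArea_apply, cross]

@[simp] theorem signedArea_right : signedArea a b b = 0 := by simp [signedArea_apply]

theorem signedArea_eq_cross_sub_right : signedArea a b x = cross (b - a) (x - b) := by
  rw [← sub_sub_sub_cancel_right x b a, cross_sub_right, cross_self, sub_zero, signedArea_apply]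

theorem signedArea_sub : signedArea a b y - signedArea a b x = cross (b - a) (y - x) := by
  simp only [signedArea_apply, cross_sub_right]; ring

theorem signedArea_add_smul (u : ℂ) (t : ℝ) :
    signedArea a b (x + t • u) = signedArea a b x + t * cross (b - a) u := by
  rw [← sub_eq_iff_eq_add', signedArea_sub, add_sub_cancel_left, cross_smul_right]

theorem continuous_signedArea : Continuous (signedArea a b) :=
  (signedArea a b).continuous_of_finiteDimensional

theorem signedArea_smul_sight (q : ℂ) :
    signedArea a b c • (b - q) = signedArea b c q • (b - a) - signedArea a b q • (c - b) := by
  apply Complex.ext <;> simp [signedArea_apply, cross] <;> ring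

theorem signedArea_mul_cross_sight (q : ℂ) :
    signedArea a b c * cross (b - q) (b - x) =
      signedArea a b q * signedArea b c x - signedArea b c q * signedArea a b x := by
  simp only [signedArea_apply, cross, Complex.sub_re, Complex.sub_im]; ring

variable {a b} in
theorem isOpenMap_signedArea (h : a ≠ b) : IsOpenMap (signedArea a b) := by
  rw [← AffineMap.isOpenMap_linear_iff]
  refine (signedArea a b).linear.isOpenMap_of_finiteDimensional ?_
  refine LinearMap.surjective fun h0 => ?_
  have happly := signedArea_add_smul a b a (Complex.I * (b - a)) 1
  have hlin := (signedArea a b).map_vadd a (Complex.I * (b - a))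
  rw [h0] at hlin
  rw [vadd_eq_add, add_comm, ← one_smul ℝ (Complex.I * (b - a)), happly, cross_mul_I] at hlin
  simp only [signedArea_left, LinearMap.zero_apply, vadd_eq_add, zero_add, one_mul, add_zero,
    ne_eq, OfNat.ofNat_ne_zero, not_false_eq_true, pow_eq_zero_iff, norm_eq_zero] at hlin
  exact h (sub_eq_zero.1 hlin).symm

end SignedArea

theorem affineMap_lineMap_eq {E : Type*} [AddCommGroup E] [Module ℝ E] (f : E →ᵃ[ℝ] ℝ) (x y : E)
    (t : ℝ) : f (AffineMap.lineMap x y t) = (1 - t) * f x + t * f y := by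
  rw [AffineMap.apply_lineMap, AffineMap.lineMap_apply_ring]

namespace ConvexPolygon

variable (K : ConvexPolygon)

instance : NeZero K.n := ⟨by have := K.three_le; omega⟩

theorem one_ne_zero_zmod : (1 : ZMod K.n) ≠ 0 := by
  have : Fact (1 < K.n) := ⟨by have := K.three_le; omega⟩
  exact one_ne_zero

theorem two_ne_zero_zmod : (2 : ZMod K.n) ≠ 0 := by
  have h3 := K.three_le
  rw [← Nat.cast_ofNat, Ne, ZMod.natCast_eq_zero_iff]
  exact fun h => absurd (Nat.le_of_dvd two_pos h) (by omega)

theorem succ_ne (i : ZMod K.n) : i + 1 ≠ i := by simpa using K.one_ne_zero_zmod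

theorem pred_ne (i : ZMod K.n) : i - 1 ≠ i := by simpa using K.one_ne_zero_zmod

theorem succ_ne_pred (i : ZMod K.n) : i + 1 ≠ i - 1 := fun h =>
  K.two_ne_zero_zmod (by linear_combination h)

/-- The signed distance of a point from the line of the edge `i`, up to a positive factor; it is
positive on the side of the polygon. -/
def side (i : ZMod K.n) : ℂ →ᵃ[ℝ] ℝ := signedArea (K.vertex i) (K.vertex (i + 1))

theorem side_pred (j : ZMod K.n) :
    K.side (j - 1) = signedArea (K.vertex (j - 1)) (K.vertex j) := by
  rw [side, sub_add_cancel]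

theorem continuous_side (i : ZMod K.n) : Continuous (K.side i) := continuous_signedArea _ _

@[simp] theorem side_vertex (i : ZMod K.n) : K.side i (K.vertex i) = 0 := signedArea_left _ _

@[simp] theorem side_vertex_succ (i : ZMod K.n) : K.side i (K.vertex (i + 1)) = 0 :=
  signedArea_right _ _

@[simp] theorem side_pred_vertex (i : ZMod K.n) : K.side (i - 1) (K.vertex i) = 0 := by
  rw [side_pred, signedArea_right]

theorem side_vertex_pos {i k : ZMod K.n} (h : k ≠ i) (h' : k ≠ i + 1) :
    0 < K.side i (K.vertex k) := K.convex i k h h'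

theorem side_vertex_nonneg (i k : ZMod K.n) : 0 ≤ K.side i (K.vertex k) := by
  by_cases h : k = i
  · simp [h]
  by_cases h' : k = i + 1
  · simp [h']
  exact (K.side_vertex_pos h h').le

theorem side_pred_vertex_succ_pos (j : ZMod K.n) : 0 < K.side (j - 1) (K.vertex (j + 1)) :=
  K.side_vertex_pos (K.succ_ne_pred j) (by rw [sub_add_cancel]; exact K.succ_ne j)

theorem vertex_ne_vertex_succ (i : ZMod K.n) : K.vertex i ≠ K.vertex (i + 1) := fun h => by
  have hpos := K.side_pred_vertex_succ_pos i
  rw [← h, side_pred_vertex] at hpos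
  exact hpos.false

theorem side_pred_smul_sight (j : ZMod K.n) (q : ℂ) :
    K.side (j - 1) (K.vertex (j + 1)) • (K.vertex j - q) =
      K.side j q • (K.vertex j - K.vertex (j - 1)) -
        K.side (j - 1) q • (K.vertex (j + 1) - K.vertex j) := by
  rw [side_pred]; exact signedArea_smul_sight _ _ _ _

theorem side_pred_mul_cross_sight (j : ZMod K.n) (q x : ℂ) :
    K.side (j - 1) (K.vertex (j + 1)) * cross (K.vertex j - q) (K.vertex j - x) =
      K.side (j - 1) q * K.side j x - K.side j q * K.side (j - 1) x := by
  rw [side_pred]; exact signedArea_mul_cross_sight _ _ _ _ _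

theorem convex_side_nonneg (i : ZMod K.n) : Convex ℝ {x | 0 ≤ K.side i x} :=
  (convex_Ici 0).affine_preimage (K.side i)

theorem convex_side_nonpos (i : ZMod K.n) : Convex ℝ {x | K.side i x ≤ 0} :=
  (convex_Iic 0).affine_preimage (K.side i)

theorem mem_convexHull_of_side_nonneg {x : ℂ} (hx : ∀ i, 0 ≤ K.side i x) :
    x ∈ convexHull ℝ (range K.vertex) := by
  by_contra hmem
  have hclosed : IsClosed (convexHull ℝ (range K.vertex)) :=
    ((finite_range K.vertex).isCompact_convexHull (𝕜 := ℝ)).isClosed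
  obtain ⟨f, u, hf, hu⟩ := geometric_hahn_banach_closed_point (convex_convexHull ℝ _) hclosed hmem
  -- At a vertex maximizing `f`, the line of sight from `x` is a nonnegative combination of the two
  -- adjacent edges, along neither of which `f` increases towards the neighbouring vertex.
  obtain ⟨j, hj⟩ := Finite.exists_max fun j => f (K.vertex j)
  have hsight := congrArg f (K.side_pred_smul_sight j x)
  simp only [map_sub, map_smul, smul_eq_mul] at hsight
  have hpred := mul_nonneg (hx j) (sub_nonneg.2 (hj (j - 1)))
  have hsucc := mul_nonneg (hx (j - 1)) (sub_nonneg.2 (hj (j + 1)))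
  have hlt : f (K.vertex j) < f x := (hf _ (subset_convexHull ℝ _ (mem_range_self j))).trans hu
  have := mul_pos (K.side_pred_vertex_succ_pos j) (sub_pos.2 hlt)
  linarith

theorem convexHull_vertex_eq : convexHull ℝ (range K.vertex) = ⋂ i, K.side i ⁻¹' Ici 0 := by
  refine subset_antisymm (subset_iInter fun i => convexHull_min ?_ (K.convex_side_nonneg i))
    fun x hx => K.mem_convexHull_of_side_nonneg (mem_iInter.1 hx)
  rintro _ ⟨k, rfl⟩
  exact K.side_vertex_nonneg i k

theorem mem_obstacle {x : ℂ} : x ∈ K.obstacle ↔ ∀ i, 0 < K.side i x := by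
  have hopen (i : ZMod K.n) : IsOpenMap (K.side i) :=
    isOpenMap_signedArea (K.vertex_ne_vertex_succ i)
  simp only [obstacle, convexHull_vertex_eq, interior_iInter_of_finite,
    ← (hopen _).preimage_interior_eq_interior_preimage (K.continuous_side _), interior_Ici,
    mem_iInter, mem_preimage, mem_Ioi]

theorem mem_free {x : ℂ} : x ∈ K.free ↔ ∃ i, K.side i x ≤ 0 := by
  simp only [free, mem_compl_iff, mem_obstacle, not_forall, not_lt]

theorem isOpen_obstacle : IsOpen K.obstacle := isOpen_interior

theorem isClosed_free : IsClosed K.free := K.isOpen_obstacle.isClosed_compl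

theorem convex_obstacle : Convex ℝ K.obstacle := (convex_convexHull ℝ _).interior

theorem isBounded_obstacle : Bornology.IsBounded K.obstacle :=
  ((finite_range K.vertex).isCompact_convexHull (𝕜 := ℝ)).isBounded.subset interior_subset

variable {K} in
theorem visible_iff_segment_subset_free {x y : ℂ} : K.Visible x y ↔ segment ℝ x y ⊆ K.free :=
  disjoint_iff_inter_eq_empty.symm.trans subset_compl_iff_disjoint_right.symm

theorem visible_of_side_nonpos {i : ZMod K.n} {x y : ℂ} (hx : K.side i x ≤ 0)
    (hy : K.side i y ≤ 0) : K.Visible x y :=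
  visible_iff_segment_subset_free.2 fun _ hz =>
    K.mem_free.2 ⟨i, (K.convex_side_nonpos i).segment_subset hx hy hz⟩

/-- The midpoint of the edge `i`, used as a point of this edge on the boundary of no other edge's
half-plane. -/
noncomputable def mid (i : ZMod K.n) : ℂ := midpoint ℝ (K.vertex i) (K.vertex (i + 1))

theorem two_mul_side_mid (i j : ZMod K.n) :
    2 * K.side i (K.mid j) = K.side i (K.vertex j) + K.side i (K.vertex (j + 1)) := by
  rw [mid, AffineMap.map_midpoint, midpoint_eq_smul_add]; simp

@[simp] theorem side_mid_self (i : ZMod K.n) : K.side i (K.mid i) = 0 := by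
  simpa using K.two_mul_side_mid i i

theorem side_mid_pos {i j : ZMod K.n} (h : i ≠ j) : 0 < K.side i (K.mid j) := by
  have hsum := K.two_mul_side_mid i j
  have hj := K.side_vertex_nonneg i j
  by_cases hij : j = i + 1
  · have hsucc : 0 < K.side i (K.vertex (j + 1)) := by
      refine K.side_vertex_pos (fun h' => K.two_ne_zero_zmod ?_)
        fun h' => h (add_right_cancel h').symm
      linear_combination h' - hij
    linarith
  · linarith [K.side_vertex_pos h.symm hij, K.side_vertex_nonneg i (j + 1)]

theorem side_mid_nonneg (i j : ZMod K.n) : 0 ≤ K.side i (K.mid j) := by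
  by_cases h : i = j
  · simp [h]
  · exact (K.side_mid_pos h).le

theorem lineMap_mid_mem_obstacle {i j : ZMod K.n} (h : i ≠ j) {t : ℝ} (ht : t ∈ Ioo (0 : ℝ) 1) :
    AffineMap.lineMap (K.mid i) (K.mid j) t ∈ K.obstacle := by
  rw [mem_obstacle]
  intro k
  rw [affineMap_lineMap_eq]
  have ht' := sub_pos.2 ht.2
  obtain rfl | hk := eq_or_ne k i
  · simpa using mul_pos ht.1 (K.side_mid_pos h)
  · exact add_pos_of_pos_of_nonneg (mul_pos ht' (K.side_mid_pos hk))
      (mul_nonneg ht.1.le (K.side_mid_nonneg k j))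

theorem obstacle_nonempty : K.obstacle.Nonempty :=
  ⟨_, K.lineMap_mid_mem_obstacle (K.succ_ne 0) (t := 1 / 2) (by norm_num)⟩

theorem eventually_lineMap_mid_mem_obstacle {x : ℂ} {i : ZMod K.n} (hx : 0 < K.side i x) :
    ∀ᶠ t in 𝓝[>] (0 : ℝ), AffineMap.lineMap (K.mid i) x t ∈ K.obstacle := by
  simp only [mem_obstacle, eventually_all]
  intro k
  obtain rfl | hk := eq_or_ne k i
  · filter_upwards [self_mem_nhdsWithin] with t (ht : 0 < t)
    rw [affineMap_lineMap_eq]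
    simpa using mul_pos ht hx
  · have hcont : Continuous fun t : ℝ => K.side k (AffineMap.lineMap (K.mid i) x t) :=
      (K.continuous_side k).comp AffineMap.lineMap_continuous
    refine (hcont.continuousAt.eventually (lt_mem_nhds ?_)).filter_mono nhdsWithin_le_nhds
    simpa using K.side_mid_pos hk

theorem seesEdge_iff {x : ℂ} {i : ZMod K.n} : K.SeesEdge x i ↔ K.side i x ≤ 0 := by
  refine ⟨fun h => ?_, fun hx y hy => K.visible_of_side_nonpos hx
    ((K.convex_side_nonpos i).segment_subset (by simp) (by simp) hy)⟩
  by_contra! hx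
  obtain ⟨t, hobs, ht⟩ := ((K.eventually_lineMap_mid_mem_obstacle hx).and
    (Ioo_mem_nhdsGT zero_lt_one)).exists
  have hvis := visible_iff_segment_subset_free.1 (h _ (midpoint_mem_segment _ _))
  rw [segment_symm, segment_eq_image_lineMap] at hvis
  exact hvis (mem_image_of_mem _ (Ioo_subset_Icc_self ht)) hobs

theorem edgeSeen_iff {P : Set ℂ} {i : ZMod K.n} : K.EdgeSeen P i ↔ ∃ x ∈ P, K.side i x ≤ 0 := by
  simp only [EdgeSeen, seesEdge_iff]

theorem not_edgeSeen_iff {P : Set ℂ} {i : ZMod K.n} :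
    ¬ K.EdgeSeen P i ↔ ∀ x ∈ P, 0 < K.side i x := by
  simp [edgeSeen_iff]

variable {K} in
theorem EdgeSeen.mono {P P' : Set ℂ} {i : ZMod K.n} (h : P ⊆ P') (hi : K.EdgeSeen P i) :
    K.EdgeSeen P' i :=
  let ⟨x, hx, hx'⟩ := hi
  ⟨x, h hx, hx'⟩

theorem visibleSet_of_finished {P : Set ℂ} (hP : K.Finished P) : K.visibleSet P = K.free := by
  refine subset_antisymm (fun x h => h.1) fun x h => ⟨h, ?_⟩
  obtain ⟨i, hi⟩ := K.mem_free.1 h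
  obtain ⟨y, hy, hyi⟩ := K.edgeSeen_iff.1 (hP i)
  exact ⟨y, hy, K.visible_of_side_nonpos hi hyi⟩

theorem sum_side_eq (x y : ℂ) : ∑ i, K.side i x = ∑ i, K.side i y := by
  have hclosed : ∑ i, (K.vertex (i + 1) - K.vertex i) = 0 := by
    rw [Finset.sum_sub_distrib, sub_eq_zero]
    exact Equiv.sum_comp (Equiv.addRight (1 : ZMod K.n)) K.vertex
  rw [← sub_eq_zero, ← Finset.sum_sub_distrib]
  simp only [side, signedArea_sub]
  rw [sum_cross_left, hclosed, cross_zero_left]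

theorem exists_side_pos (s : ℂ) : ∃ i, 0 < K.side i s := by
  obtain ⟨o, ho⟩ := K.obstacle_nonempty
  have hpos : 0 < ∑ i, K.side i s := by
    rw [K.sum_side_eq s o]
    exact Finset.sum_pos (fun i _ => K.mem_obstacle.1 ho i) ⟨0, Finset.mem_univ _⟩
  simpa using Finset.exists_lt_of_sum_lt (s := Finset.univ) (f := fun _ => 0) (by simpa using hpos)

end ConvexPolygon

/-! ### Scopes and their angle -/

section Plane

variable {a b c w : ℂ}

theorem im_div_eq (a b : ℂ) : (b / a).im = cross a b / Complex.normSq a := by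
  rw [Complex.div_im, cross]; ring

theorem inner_eq (a b : ℂ) : inner ℝ a b = a.re * b.re + a.im * b.im := by
  rw [Complex.inner, Complex.mul_re, Complex.conj_re, Complex.conj_im]; ring

theorem exists_eq_smul_of_cross_eq_zero (ha : a ≠ 0) (h : cross a b = 0) : ∃ t : ℝ, b = t • a := by
  refine ⟨(b / a).re, ?_⟩
  have him : (b / a).im = 0 := by rw [im_div_eq, h, zero_div]
  rw [Complex.real_smul, Complex.ext (Complex.ofReal_re _) (him.symm ▸ Complex.ofReal_im _),
    div_mul_cancel₀ _ ha]

theorem cross_eq_zero_trans (ha : a ≠ 0) (hb : cross a b = 0) (hc : cross a c = 0) :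
    cross b c = 0 := by
  obtain ⟨s, rfl⟩ := exists_eq_smul_of_cross_eq_zero ha hb
  obtain ⟨t, rfl⟩ := exists_eq_smul_of_cross_eq_zero ha hc
  rw [cross_smul_left, cross_smul_right, cross_self, mul_zero, mul_zero]

theorem cross_I_mul_left (w a : ℂ) : cross (Complex.I * w) a = -inner ℝ w a := by
  rw [inner_eq]; simp [cross]; ring

theorem cross_eq_zero_of_inner_eq_zero (hw : w ≠ 0) (ha : inner ℝ w a = 0)
    (hb : inner ℝ w b = 0) : cross a b = 0 :=
  cross_eq_zero_trans (mul_ne_zero Complex.I_ne_zero hw) (by rw [cross_I_mul_left, ha, neg_zero])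
    (by rw [cross_I_mul_left, hb, neg_zero])

theorem arg_smul_div_smul {s t : ℝ} (hs : 0 < s) (ht : 0 < t) (a b : ℂ) :
    Complex.arg (t • b / s • a) = Complex.arg (b / a) := by
  rw [smul_div_assoc, Complex.real_smul, Complex.arg_real_mul _ ht, ← inv_inv s, Complex.real_smul,
    Complex.ofReal_inv, ← div_div, div_inv_eq_mul, mul_comm b, mul_div_assoc,
    Complex.arg_real_mul _ (inv_pos.2 hs)]

theorem exists_eq_lineMap_of_signedArea_eq_zero {x : ℂ} (hab : a ≠ b)
    (h : signedArea a b x = 0) : ∃ t : ℝ, x = AffineMap.lineMap a b t := by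
  obtain ⟨t, ht⟩ := exists_eq_smul_of_cross_eq_zero (sub_ne_zero.2 hab.symm) h
  exact ⟨t, by rw [AffineMap.lineMap_apply_module', ← ht, sub_add_cancel]⟩

theorem exists_pos_smul_eq_of_cross_eq_zero (f : ℂ →ᵃ[ℝ] ℝ) {v q q' : ℂ} (hv : f v = 0)
    (hq : 0 < f q) (hq' : 0 < f q') (h : cross (v - q) (v - q') = 0) :
    ∃ t : ℝ, 0 < t ∧ v - q' = t • (v - q) := by
  have hvq : v - q ≠ 0 := by
    rintro hvq
    rw [← sub_eq_zero.1 hvq, hv] at hq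
    exact hq.false
  obtain ⟨t, ht⟩ := exists_eq_smul_of_cross_eq_zero hvq h
  have hft : f q' = t * f q := by
    rw [show q' = AffineMap.lineMap v q t by
      rw [AffineMap.lineMap_apply_module', ← neg_sub v q, smul_neg, ← ht]; abel,
      affineMap_lineMap_eq, hv, mul_zero, zero_add]
  exact ⟨t, pos_of_mul_pos_left (hft ▸ hq') hq.le, ht⟩

theorem signedArea_swap (a b x : ℂ) : signedArea b a x = -signedArea a b x := by
  rw [signedArea_apply, signedArea_eq_cross_sub_right a b, ← neg_sub b a, cross_neg_left]

theorem two_mul_signedArea_midpoint_left (a b c : ℂ) :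
    2 * signedArea (midpoint ℝ a b) c a = signedArea a b c := by
  rw [midpoint_eq_smul_add]
  simp [signedArea_apply, cross]; ring

theorem two_mul_signedArea_midpoint_right (a b c : ℂ) :
    2 * signedArea (midpoint ℝ a b) c b = -signedArea a b c := by
  rw [midpoint_comm, two_mul_signedArea_midpoint_left, signedArea_swap]

theorem cross_I_mul_right (w a : ℂ) : cross w (Complex.I * a) = inner ℝ w a := by
  rw [cross_swap, cross_I_mul_left, neg_neg, real_inner_comm]

theorem inner_ne_zero_of_cross_eq_zero {a b : ℂ} (ha : a ≠ 0) (hb : b ≠ 0) (h : cross a b = 0) :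
    inner ℝ a b ≠ 0 := by
  obtain ⟨t, rfl⟩ := exists_eq_smul_of_cross_eq_zero ha h
  rw [inner_smul_right]
  exact mul_ne_zero (smul_ne_zero_iff.1 hb).1 (real_inner_self_pos.2 ha).ne'

theorem exists_norm_eq_one_cross_eq_zero (b : ℂ) : ∃ w : ℂ, ‖w‖ = 1 ∧ cross w b = 0 := by
  obtain rfl | hb := eq_or_ne b 0
  · exact ⟨1, norm_one, by rw [cross_swap, cross_zero_left, neg_zero]⟩
  · exact ⟨‖b‖⁻¹ • b, norm_smul_inv_norm hb, by rw [cross_smul_left, cross_self, mul_zero]⟩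

end Plane

theorem mul_pos_of_isPreconnected {α : Type*} [TopologicalSpace α] {P : Set α} {f : α → ℝ}
    (hP : IsPreconnected P) (hf : ContinuousOn f P) (h0 : ∀ z ∈ P, f z ≠ 0) {x y : α}
    (hx : x ∈ P) (hy : y ∈ P) : 0 < f x * f y := by
  by_contra! hneg
  have hzero : (0 : ℝ) ∈ uIcc (f x) (f y) := by
    rw [mem_uIcc]
    exact (mul_nonpos_iff.1 hneg).symm.imp_right And.symm
  obtain ⟨z, hz, hz0⟩ := (hP.image f hf).ordConnected.uIcc_subset (mem_image_of_mem f hx)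
    (mem_image_of_mem f hy) hzero
  exact h0 z hz hz0

namespace ConvexPolygon

variable {K : ConvexPolygon} {i j : ZMod K.n}

variable (K) in
theorem vertex_injective : Function.Injective K.vertex := by
  intro i j h
  by_contra hij
  by_cases hji : j = i + 1
  · exact K.vertex_ne_vertex_succ i (hji ▸ h)
  · have hpos := K.side_vertex_pos (Ne.symm hij) hji
    rw [← h, side_vertex] at hpos
    exact hpos.false

section Chord

variable (K) in
/-- The position of a point with respect to the chord from the midpoint of the edge `i` to the
midpoint of the edge `j`: positive on its left. As long as neither edge has been seen, the robot
cannot cross this chord. -/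
noncomputable def chord (i j : ZMod K.n) : ℂ →ᵃ[ℝ] ℝ := signedArea (K.mid i) (K.mid j)

theorem chord_swap (i j : ZMod K.n) (x : ℂ) : K.chord j i x = -K.chord i j x :=
  signedArea_swap _ _ _

theorem chord_vertex_pos (h : i ≠ j) : 0 < K.chord i j (K.vertex i) := by
  have hval : 2 * K.chord i j (K.vertex i) = K.side i (K.mid j) :=
    two_mul_signedArea_midpoint_left _ _ _
  linarith [K.side_mid_pos h]

theorem chord_vertex_succ_neg (h : i ≠ j) : K.chord i j (K.vertex (i + 1)) < 0 := by
  have hval : 2 * K.chord i j (K.vertex (i + 1)) = -K.side i (K.mid j) :=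
    two_mul_signedArea_midpoint_right _ _ _
  linarith [K.side_mid_pos h]

theorem chord_ne_zero (h : i ≠ j) {x : ℂ} (hx : x ∈ K.free) (hi : 0 < K.side i x)
    (hj : 0 < K.side j x) : K.chord i j x ≠ 0 := by
  intro h0
  have hij := K.side_mid_pos h
  have hji := K.side_mid_pos h.symm
  have hmid : K.mid i ≠ K.mid j := fun heq => by simp [← heq] at hij
  obtain ⟨t, rfl⟩ := exists_eq_lineMap_of_signedArea_eq_zero hmid h0
  rw [affineMap_lineMap_eq, side_mid_self] at hi hj
  refine hx (K.lineMap_mid_mem_obstacle h ⟨?_, ?_⟩)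
  · exact pos_of_mul_pos_left (by simpa using hi) hij.le
  · exact sub_pos.1 (pos_of_mul_pos_left (by simpa using hj) hji.le)

theorem chord_mul_pos_of_side_nonpos (h : i ≠ j) {k : ZMod K.n} {x y : ℂ} (hx : K.side k x ≤ 0)
    (hy : K.side k y ≤ 0) (hix : 0 < K.side i x) (hjx : 0 < K.side j x) (hiy : 0 ≤ K.side i y)
    (hjy : 0 ≤ K.side j y) (hne : K.chord i j y ≠ 0) : 0 < K.chord i j x * K.chord i j y := by
  refine mul_pos_of_isPreconnected (convex_segment x y).isPreconnected
    (continuous_signedArea _ _).continuousOn (fun z hz => ?_) (left_mem_segment ℝ x y)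
    (right_mem_segment ℝ x y)
  have hkz := (K.convex_side_nonpos k).segment_subset hx hy hz
  rw [segment_eq_image_lineMap] at hz
  obtain ⟨t, ht, rfl⟩ := hz
  obtain rfl | ht1 := ht.2.eq_or_lt
  · rwa [AffineMap.lineMap_apply_one]
  have hpos {l : ZMod K.n} (hlx : 0 < K.side l x) (hly : 0 ≤ K.side l y) :
      0 < K.side l (AffineMap.lineMap x y t) := by
    rw [affineMap_lineMap_eq]
    exact add_pos_of_pos_of_nonneg (mul_pos (sub_pos.2 ht1) hlx) (mul_nonneg ht.1 hly)
  exact chord_ne_zero h (K.mem_free.2 ⟨k, hkz⟩) (hpos hix hiy) (hpos hjx hjy)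

theorem chord_pos_of_side_pred_nonpos (h : i ≠ j) {x : ℂ} (hx : K.side (i - 1) x ≤ 0)
    (hi : 0 < K.side i x) (hj : 0 < K.side j x) : 0 < K.chord i j x :=
  pos_of_mul_pos_left (chord_mul_pos_of_side_nonpos h hx (by simp) hi hj
    (K.side_vertex_nonneg _ _) (K.side_vertex_nonneg _ _) (chord_vertex_pos h).ne')
    (chord_vertex_pos h).le

theorem chord_neg_of_side_succ_nonpos (h : i ≠ j) {x : ℂ} (hx : K.side (i + 1) x ≤ 0)
    (hi : 0 < K.side i x) (hj : 0 < K.side j x) : K.chord i j x < 0 :=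
  neg_of_mul_pos_left (chord_mul_pos_of_side_nonpos h hx (by simp) hi hj
    (K.side_vertex_nonneg _ _) (K.side_vertex_nonneg _ _) (chord_vertex_succ_neg h).ne)
    (chord_vertex_succ_neg h).le

theorem chord_mul_pos (h : i ≠ j) {P : Set ℂ} (hP : IsPreconnected P) (hF : P ⊆ K.free)
    (hi : ¬ K.EdgeSeen P i) (hj : ¬ K.EdgeSeen P j) {x y : ℂ} (hx : x ∈ P) (hy : y ∈ P) :
    0 < K.chord i j x * K.chord i j y := by
  rw [not_edgeSeen_iff] at hi hj
  exact mul_pos_of_isPreconnected hP (continuous_signedArea _ _).continuousOn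
    (fun z hz => chord_ne_zero h (hF hz) (hi z hz) (hj z hz)) hx hy

theorem eq_of_edgeSeen_pred {P : Set ℂ} (hP : IsPreconnected P) (hF : P ⊆ K.free)
    (hi : ¬ K.EdgeSeen P i) (hj : ¬ K.EdgeSeen P j) (hi' : K.EdgeSeen P (i - 1))
    (hj' : K.EdgeSeen P (j - 1)) : i = j := by
  by_contra hne
  obtain ⟨x, hx, hxi⟩ := K.edgeSeen_iff.1 hi'
  obtain ⟨y, hy, hyj⟩ := K.edgeSeen_iff.1 hj'
  have hprod := chord_mul_pos hne hP hF hi hj hx hy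
  rw [not_edgeSeen_iff] at hi hj
  have hxpos := chord_pos_of_side_pred_nonpos hne hxi (hi x hx) (hj x hx)
  have hypos := chord_pos_of_side_pred_nonpos (Ne.symm hne) hyj (hj y hy) (hi y hy)
  rw [chord_swap] at hypos
  nlinarith

theorem eq_of_edgeSeen_succ {P : Set ℂ} (hP : IsPreconnected P) (hF : P ⊆ K.free)
    (hi : ¬ K.EdgeSeen P i) (hj : ¬ K.EdgeSeen P j) (hi' : K.EdgeSeen P (i + 1))
    (hj' : K.EdgeSeen P (j + 1)) : i = j := by
  by_contra hne
  obtain ⟨x, hx, hxi⟩ := K.edgeSeen_iff.1 hi'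
  obtain ⟨y, hy, hyj⟩ := K.edgeSeen_iff.1 hj'
  have hprod := chord_mul_pos hne hP hF hi hj hx hy
  rw [not_edgeSeen_iff] at hi hj
  have hxneg := chord_neg_of_side_succ_nonpos hne hxi (hi x hx) (hj x hx)
  have hyneg := chord_neg_of_side_succ_nonpos (Ne.symm hne) hyj (hj y hy) (hi y hy)
  rw [chord_swap] at hyneg
  nlinarith

end Chord

section Sight

variable (K) in
theorem side_pred_mul_cross_sight_sub (j : ZMod K.n) (q x : ℂ) :
    K.side (j - 1) (K.vertex (j + 1)) * cross (K.vertex j - q) (x - K.vertex j) =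
      K.side j q * K.side (j - 1) x - K.side (j - 1) q * K.side j x := by
  rw [← neg_sub (K.vertex j) x, cross_neg_right, mul_neg, side_pred_mul_cross_sight]; ring

theorem cross_sight_nonneg {q x : ℂ} (hq : K.side (j - 1) q ≤ 0) (hq' : 0 ≤ K.side j q)
    (hx : ∀ i, 0 ≤ K.side i x) : 0 ≤ cross (K.vertex j - q) (x - K.vertex j) := by
  refine nonneg_of_mul_nonneg_right ?_ (K.side_pred_vertex_succ_pos j)
  rw [side_pred_mul_cross_sight_sub]
  linarith [mul_nonneg hq' (hx (j - 1)), mul_nonpos_of_nonpos_of_nonneg hq (hx j)]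

theorem cross_sight_nonpos {q x : ℂ} (hq : K.side j q ≤ 0) (hq' : 0 ≤ K.side (j - 1) q)
    (hx : ∀ i, 0 ≤ K.side i x) : cross (K.vertex j - q) (x - K.vertex j) ≤ 0 := by
  refine nonpos_of_mul_nonpos_right ?_ (K.side_pred_vertex_succ_pos j)
  rw [side_pred_mul_cross_sight_sub]
  linarith [mul_nonneg hq' (hx j), mul_nonpos_of_nonpos_of_nonneg hq (hx (j - 1))]

theorem cross_sight_pos {q x : ℂ} (hq : K.side (j - 1) q ≤ 0) (hq' : 0 < K.side j q)
    (hx : x ∈ K.obstacle) : 0 < cross (K.vertex j - q) (x - K.vertex j) := by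
  rw [mem_obstacle] at hx
  refine pos_of_mul_pos_right ?_ (K.side_pred_vertex_succ_pos j).le
  rw [side_pred_mul_cross_sight_sub]
  linarith [mul_pos hq' (hx (j - 1)), mul_nonpos_of_nonpos_of_nonneg hq (hx j).le]

theorem cross_sight_neg {q x : ℂ} (hq : K.side j q ≤ 0) (hq' : 0 < K.side (j - 1) q)
    (hx : x ∈ K.obstacle) : cross (K.vertex j - q) (x - K.vertex j) < 0 := by
  rw [mem_obstacle] at hx
  refine neg_of_mul_neg_right ?_ (K.side_pred_vertex_succ_pos j).le
  rw [side_pred_mul_cross_sight_sub]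
  linarith [mul_pos hq' (hx j), mul_nonpos_of_nonpos_of_nonneg hq (hx (j - 1)).le]

end Sight

namespace IsScope

variable {P : Set ℂ} {σ σ' : K.Scope}

theorem side_pR_pos (h : K.IsScope P σ) : 0 < K.side σ.R σ.pR :=
  K.not_edgeSeen_iff.1 h.unseenR _ h.memR

theorem side_pR_nonpos (h : K.IsScope P σ) : K.side (σ.R - 1) σ.pR ≤ 0 := K.seesEdge_iff.1 h.seesR

theorem side_pL_pos (h : K.IsScope P σ) : 0 < K.side (σ.L - 1) σ.pL :=
  K.not_edgeSeen_iff.1 h.unseenL _ h.memL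

theorem side_pL_nonpos (h : K.IsScope P σ) : K.side σ.L σ.pL ≤ 0 := K.seesEdge_iff.1 h.seesL

theorem not_finished (h : K.IsScope P σ) : ¬ K.Finished P := fun hf => h.unseenR (hf _)

theorem R_ne_L (h : K.IsScope P σ) : σ.R ≠ σ.L := fun e => h.unseenR (e ▸ h.seenL)

theorem uR_ne_zero (h : K.IsScope P σ) : σ.uR ≠ 0 := fun e => by
  have hpos := h.side_pR_pos
  rw [← sub_eq_zero.1 e, Scope.vR, side_vertex] at hpos
  exact hpos.false

theorem uL_ne_zero (h : K.IsScope P σ) : σ.uL ≠ 0 := fun e => by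
  have hpos := h.side_pL_pos
  rw [← sub_eq_zero.1 e, Scope.vL, side_pred_vertex] at hpos
  exact hpos.false

theorem vL_sub_vR_ne_zero (h : K.IsScope P σ) : σ.vL - σ.vR ≠ 0 :=
  sub_ne_zero.2 (K.vertex_injective.ne h.R_ne_L.symm)

theorem cross_uR_pos (h : K.IsScope P σ) {x : ℂ} (hx : x ∈ K.obstacle) :
    0 < cross σ.uR (x - σ.vR) :=
  cross_sight_pos h.side_pR_nonpos h.side_pR_pos hx

theorem cross_uL_neg (h : K.IsScope P σ) {x : ℂ} (hx : x ∈ K.obstacle) :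
    cross σ.uL (x - σ.vL) < 0 :=
  cross_sight_neg h.side_pL_nonpos h.side_pL_pos hx

theorem cross_uR_vL_sub_vR_nonneg (h : K.IsScope P σ) : 0 ≤ cross σ.uR (σ.vL - σ.vR) :=
  cross_sight_nonneg h.side_pR_nonpos h.side_pR_pos.le fun i => K.side_vertex_nonneg i _

theorem cross_uL_vL_sub_vR_nonneg (h : K.IsScope P σ) : 0 ≤ cross σ.uL (σ.vL - σ.vR) := by
  rw [← neg_sub, cross_neg_right, neg_nonneg]
  exact cross_sight_nonpos h.side_pL_nonpos h.side_pL_pos.le fun i => K.side_vertex_nonneg i _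

theorem R_eq (hP : IsPreconnected P) (hF : P ⊆ K.free) (h : K.IsScope P σ)
    (h' : K.IsScope P σ') : σ.R = σ'.R :=
  eq_of_edgeSeen_pred hP hF h.unseenR h'.unseenR h.seenR h'.seenR

theorem L_eq (hP : IsPreconnected P) (hF : P ⊆ K.free) (h : K.IsScope P σ)
    (h' : K.IsScope P σ') : σ.L = σ'.L :=
  sub_left_injective <| eq_of_edgeSeen_succ hP hF h.unseenL h'.unseenL
    (by rw [sub_add_cancel]; exact h.seenL) (by rw [sub_add_cancel]; exact h'.seenL)

theorem angle_eq_of_R_eq_of_L_eq (h : K.IsScope P σ) (h' : K.IsScope P σ') (hR : σ.R = σ'.R)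
    (hL : σ.L = σ'.L) : σ.angle = σ'.angle := by
  obtain ⟨R, L, pR, pL⟩ := σ
  obtain ⟨R', L', pR', pL'⟩ := σ'
  obtain rfl : R = R' := hR
  obtain rfl : L = L' := hL
  have hcrossR : cross (K.vertex R - pR') (K.vertex R - pR) = 0 :=
    le_antisymm (by rw [cross_swap]; exact neg_nonpos.2 (h'.extremeR _ h.memR h.seesR))
      (h.extremeR _ h'.memR h'.seesR)
  have hcrossL : cross (K.vertex L - pL') (K.vertex L - pL) = 0 :=
    le_antisymm (h.extremeL _ h'.memL h'.seesL)
      (by rw [cross_swap]; exact neg_nonneg.2 (h'.extremeL _ h.memL h.seesL))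
  obtain ⟨c, hc, hcR⟩ := exists_pos_smul_eq_of_cross_eq_zero (K.side R) (K.side_vertex R)
    h'.side_pR_pos h.side_pR_pos hcrossR
  obtain ⟨d, hd, hdL⟩ := exists_pos_smul_eq_of_cross_eq_zero (K.side (L - 1))
    (K.side_pred_vertex L) h'.side_pL_pos h.side_pL_pos hcrossL
  simp only [Scope.angle, Scope.uR, Scope.uL, Scope.vR, Scope.vL]
  rw [hcR, hdL, arg_smul_div_smul hc hd]

theorem angle_eq (hP : IsPreconnected P) (hF : P ⊆ K.free) (h : K.IsScope P σ)
    (h' : K.IsScope P σ') : σ.angle = σ'.angle :=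
  h.angle_eq_of_R_eq_of_L_eq h' (R_eq hP hF h h') (L_eq hP hF h h')

theorem angle_nonneg_of_pR_eq_pL (h : K.IsScope P σ) (hp : σ.pR = σ.pL) : 0 ≤ σ.angle := by
  have hcross : cross σ.uR σ.uL = cross σ.uR (σ.vL - σ.vR) := by
    rw [Scope.uL, ← hp, ← sub_add_sub_cancel σ.vL σ.vR σ.pR, ← Scope.uR, add_comm,
      ← sub_neg_eq_add, cross_sub_right, cross_self, cross_neg_right, zero_sub, neg_neg]
  rw [Scope.angle, Complex.arg_nonneg_iff, im_div_eq, hcross]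
  exact div_nonneg h.cross_uR_vL_sub_vR_nonneg (Complex.normSq_nonneg _)

theorem add_smul_mem_free_of_pR_eq_pL (h : K.IsScope P σ) (hp : σ.pR = σ.pL) (t : ℝ) :
    σ.pR + t • (σ.vL - σ.vR) ∈ K.free := by
  intro hx
  -- On this line the two crossed areas agree, while the obstacle lies between the lines of sight.
  have hcross : cross σ.uR (σ.pR + t • (σ.vL - σ.vR) - σ.vR) =
      cross σ.uL (σ.pR + t • (σ.vL - σ.vR) - σ.vL) := by
    simp only [Scope.uR, Scope.uL, ← hp, cross, Complex.sub_re, Complex.sub_im, Complex.add_re,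
      Complex.add_im, Complex.smul_re, Complex.smul_im, smul_eq_mul]
    ring
  linarith [h.cross_uR_pos hx, h.cross_uL_neg hx]

theorem angle_eq_pi_of_cross_eq_zero (h : K.IsScope P σ) (hR : cross σ.uR (σ.vL - σ.vR) = 0)
    (hL : cross σ.uL (σ.vL - σ.vR) = 0) : σ.angle = Real.pi := by
  obtain ⟨c, hc⟩ := exists_eq_smul_of_cross_eq_zero h.uR_ne_zero <|
    cross_eq_zero_trans h.vL_sub_vR_ne_zero (by rw [cross_swap, hR, neg_zero])
      (by rw [cross_swap, hL, neg_zero])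
  obtain ⟨x, hx⟩ := K.obstacle_nonempty
  have hcross : cross σ.uL (x - σ.vL) = c * cross σ.uR (x - σ.vR) := by
    rw [← sub_sub_sub_cancel_right x σ.vL σ.vR, cross_sub_right, hL, sub_zero, hc, cross_smul_left]
  have hneg : c < 0 := neg_of_mul_neg_left (hcross ▸ h.cross_uL_neg hx) (h.cross_uR_pos hx).le
  rw [Scope.angle, hc, Complex.real_smul, mul_div_cancel_right₀ _ h.uR_ne_zero,
    Complex.arg_ofReal_of_neg hneg]

theorem inner_vL_sub_vR_ne_zero (h : K.IsScope P σ) (hangle : σ.angle ≠ Real.pi) {w : ℂ}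
    (hw : w ≠ 0) (hperp : inner ℝ w (‖σ.uR‖⁻¹ • σ.uR + ‖σ.uL‖⁻¹ • σ.uL) = 0) :
    inner ℝ w (σ.vL - σ.vR) ≠ 0 := by
  intro h0
  have hR : 0 < ‖σ.uR‖⁻¹ := inv_pos.2 (norm_pos_iff.2 h.uR_ne_zero)
  have hL : 0 < ‖σ.uL‖⁻¹ := inv_pos.2 (norm_pos_iff.2 h.uL_ne_zero)
  have hsum : ‖σ.uR‖⁻¹ * cross σ.uR (σ.vL - σ.vR) + ‖σ.uL‖⁻¹ * cross σ.uL (σ.vL - σ.vR) = 0 := by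
    rw [← cross_eq_zero_of_inner_eq_zero hw hperp h0]
    simp only [cross, Complex.add_re, Complex.add_im, Complex.smul_re, Complex.smul_im,
      smul_eq_mul]
    ring
  rw [add_eq_zero_iff_of_nonneg (mul_nonneg hR.le h.cross_uR_vL_sub_vR_nonneg)
    (mul_nonneg hL.le h.cross_uL_vL_sub_vR_nonneg)] at hsum
  exact hangle <| h.angle_eq_pi_of_cross_eq_zero ((mul_eq_zero_iff_left hR.ne').1 hsum.1)
    ((mul_eq_zero_iff_left hL.ne').1 hsum.2)

end IsScope

end ConvexPolygon

/-! ### Existence of scopes and of closing targets, and stopping conditions -/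

section OuterRay

variable {a b : ℂ}

theorem lineMap_mem_outerRay {t : ℝ} (ht : t ≤ 0) : AffineMap.lineMap a b t ∈ outerRay a b :=
  ⟨-t, neg_nonneg.2 ht, by rw [AffineMap.lineMap_apply_module']; module⟩

theorem lineMap_mem_outerRay_swap {t : ℝ} (ht : 1 ≤ t) :
    AffineMap.lineMap a b t ∈ outerRay b a := by
  rw [← AffineMap.lineMap_apply_one_sub]
  exact lineMap_mem_outerRay (by linarith)

theorem isClosed_outerRay (a b : ℂ) : IsClosed (outerRay a b) := by
  have himage : outerRay a b = (a + ·) '' ((· • (a - b)) '' Ici (0 : ℝ)) := by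
    ext q
    simp only [outerRay, mem_ofPred_eq, image_image, mem_image, mem_Ici, eq_comm]
  rw [himage]
  exact isClosedMap_add_left a _ (isClosedMap_smul_left (a - b) _ isClosed_Ici)

theorem exists_mem_outerRay_eq_zero (f : ℂ →ᵃ[ℝ] ℝ) (ha : 0 ≤ f a) (hb : 0 ≤ f b)
    (hab : f a ≠ f b) : ∃ q, (q ∈ outerRay a b ∨ q ∈ outerRay b a) ∧ f q = 0 := by
  wlog hlt : f b < f a generalizing a b
  · obtain ⟨q, hq, hq0⟩ := this hb ha hab.symm (hab.lt_of_le (not_lt.1 hlt))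
    exact ⟨q, hq.symm, hq0⟩
  have hpos := sub_pos.2 hlt
  refine ⟨AffineMap.lineMap a b (f a / (f a - f b)),
    Or.inr (lineMap_mem_outerRay_swap ((one_le_div hpos).2 (by linarith))), ?_⟩
  rw [affineMap_lineMap_eq]
  field_simp
  ring

end OuterRay

theorem cross_nonneg_of_quadrants {a u v : ℂ} (ha : a ≠ 0) (hu : 0 ≤ cross a u)
    (hu' : 0 ≤ inner ℝ a u) (hv : 0 ≤ cross a v) (hv' : inner ℝ a v ≤ 0) : 0 ≤ cross u v := by
  have hdecomp : Complex.normSq a * cross u v =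
      inner ℝ a u * cross a v - cross a u * inner ℝ a v := by
    rw [inner_eq, inner_eq, Complex.normSq_apply]; simp only [cross]; ring
  refine nonneg_of_mul_nonneg_right (a := Complex.normSq a) ?_ (Complex.normSq_pos.2 ha)
  rw [hdecomp]
  linarith [mul_nonneg hu' hv, mul_nonpos_of_nonneg_of_nonpos hu hv']

theorem arg_le_of_tendsto {ι : Type*} {l : Filter ι} [l.NeBot] {a b : ℂ} {u v : ι → ℂ} {θ : ℝ}
    (hθ : θ ≤ Real.pi / 2) (ha : a ≠ 0) (hb : b ≠ 0) (hu : Tendsto u l (𝓝 a))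
    (hv : Tendsto v l (𝓝 b)) (hau : ∀ k, 0 ≤ cross a (u k)) (hbv : ∀ k, cross b (v k) ≤ 0)
    (harg : ∀ k, Complex.arg (v k / u k) ≤ θ) : Complex.arg (b / a) ≤ θ := by
  have hdiv : Tendsto (fun k => v k / u k) l (𝓝 (b / a)) := hv.div hu ha
  by_cases hslit : b / a ∈ Complex.slitPlane
  · exact le_of_tendsto' ((Complex.continuousAt_arg hslit).tendsto.comp hdiv) harg
  -- `arg` jumps at the negative reals, but the hypotheses on `u` and `v` keep `v / u` above them.
  exfalso
  rw [Complex.mem_slitPlane_iff, not_or, not_lt, not_not] at hslit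
  have hre : (b / a).re < 0 :=
    hslit.1.lt_of_ne fun h0 => div_ne_zero hb ha (Complex.ext h0 hslit.2)
  obtain ⟨c, rfl⟩ : ∃ c : ℝ, b = c • a := exists_eq_smul_of_cross_eq_zero ha <| by
    have him := hslit.2
    rw [im_div_eq, div_eq_zero_iff] at him
    exact him.resolve_right (Complex.normSq_pos.2 ha).ne'
  have hc : c < 0 := by simpa [ha] using hre
  have haa : 0 < inner ℝ a a := real_inner_self_pos.2 ha
  have hinneru : Tendsto (fun k => inner ℝ a (u k)) l (𝓝 (inner ℝ a a)) :=
    tendsto_const_nhds.inner hu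
  have hinnerv : Tendsto (fun k => inner ℝ a (v k)) l (𝓝 (inner ℝ a (c • a))) :=
    tendsto_const_nhds.inner hv
  have hcaa : inner ℝ a (c • a) < 0 := by
    rw [real_inner_smul_right]; exact mul_neg_of_neg_of_pos hc haa
  obtain ⟨k, hk, hku, hkv⟩ :=
    ((((Complex.continuous_re.tendsto _).comp hdiv).eventually_lt_const hre).and
      ((hinneru.eventually_const_lt haa).and (hinnerv.eventually_lt_const hcaa))).exists
  have hav : 0 ≤ cross a (v k) := by
    have hcv := hbv k
    rw [cross_smul_left] at hcv
    exact nonneg_of_mul_nonpos_right hcv hc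
  have harg0 : 0 ≤ Complex.arg (v k / u k) := by
    rw [Complex.arg_nonneg_iff, im_div_eq]
    exact div_nonneg (cross_nonneg_of_quadrants ha (hau k) hku.le hav hkv.le)
      (Complex.normSq_nonneg _)
  have habs : |Complex.arg (v k / u k)| ≤ Real.pi / 2 :=
    (abs_of_nonneg harg0).trans_le ((harg k).trans hθ)
  exact (Complex.abs_arg_le_pi_div_two_iff.1 habs).not_gt hk

theorem exists_isMinOn_ratio {X : Type*} [TopologicalSpace X] {P : Set X} (hP : IsCompact P)
    {f g : X → ℝ} (hf : Continuous f) (hg : Continuous g) (hneg : ∃ x ∈ P, f x ≤ 0)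
    (hpos : ∀ x ∈ P, 0 < g x) :
    ∃ p ∈ P, f p ≤ 0 ∧ ∀ q ∈ P, f q ≤ 0 → f p * g q ≤ f q * g p := by
  obtain ⟨p, hp, hmin⟩ := (hP.inter_right (isClosed_le hf continuous_const)).exists_isMinOn
    (s := P ∩ {x | f x ≤ 0}) hneg
    (hf.continuousOn.div hg.continuousOn fun x hx => (hpos x hx.1).ne')
  exact ⟨p, hp.1, hp.2, fun q hq hq' =>
    (div_le_div_iff₀ (hpos p hp.1) (hpos q hq)).1 (hmin ⟨hq, hq'⟩)⟩

theorem exists_tendsto_subseq_image_Icc {X : Type*} [TopologicalSpace X] {f : ℝ → X}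
    (hf : ContinuousOn f (Ici 0)) {u : ℕ → ℝ} {T : ℝ} (hu : Tendsto u atTop (𝓝 T)) {p : ℕ → X}
    (hp : ∀ k, p k ∈ f '' Icc 0 (u k)) :
    ∃ x ∈ f '' Icc 0 T, ∃ φ : ℕ → ℕ, StrictMono φ ∧ Tendsto (p ∘ φ) atTop (𝓝 x) := by
  choose t ht htp using hp
  obtain ⟨B, hB⟩ := hu.bddAbove_range
  obtain ⟨a, ha, φ, hφ, hlim⟩ := isCompact_Icc.tendsto_subseq (x := t) (s := Icc 0 B)
    fun k => ⟨(ht k).1, (ht k).2.trans (hB (mem_range_self k))⟩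
  have haT : a ≤ T :=
    le_of_tendsto_of_tendsto' hlim (hu.comp hφ.tendsto_atTop) fun k => (ht (φ k)).2
  refine ⟨f a, mem_image_of_mem f ⟨ha.1, haT⟩, φ, hφ, ?_⟩
  rw [← funext htp]
  exact (hf a ha.1).tendsto.comp
    (tendsto_nhdsWithin_iff.2 ⟨hlim, Eventually.of_forall fun k => (ht (φ k)).1⟩)

namespace ConvexPolygon

variable {K : ConvexPolygon}

section ScopeExistence

theorem exists_pred_and_not {p : ZMod K.n → Prop} {i j : ZMod K.n} (hi : p i) (hj : ¬ p j) :
    ∃ k, p (k - 1) ∧ ¬ p k := by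
  by_contra! hstep
  have hall (m : ℕ) : p (i + m) := by
    induction m with
    | zero => simpa
    | succ m ih =>
      refine hstep _ ?_
      rwa [Nat.cast_succ, ← add_assoc, add_sub_cancel_right]
  exact hj (by simpa using hall (j - i).val)

theorem exists_and_not_pred {p : ZMod K.n → Prop} {i j : ZMod K.n} (hi : p i) (hj : ¬ p j) :
    ∃ k, p k ∧ ¬ p (k - 1) := by
  obtain ⟨k, hk, hk'⟩ := exists_pred_and_not (p := fun k => ¬ p k) hj (not_not.2 hi)
  exact ⟨k, not_not.1 hk', hk⟩

variable {P : Set ℂ} {j : ZMod K.n}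

theorem exists_extremeR (hP : IsCompact P) (hpred : K.EdgeSeen P (j - 1))
    (hj : ¬ K.EdgeSeen P j) :
    ∃ p ∈ P, K.SeesEdge p (j - 1) ∧
      ∀ q ∈ P, K.SeesEdge q (j - 1) → 0 ≤ cross (K.vertex j - q) (K.vertex j - p) := by
  simp only [seesEdge_iff]
  obtain ⟨p, hp, hpj, hmin⟩ := exists_isMinOn_ratio hP (K.continuous_side (j - 1))
    (K.continuous_side j) (K.edgeSeen_iff.1 hpred) (K.not_edgeSeen_iff.1 hj)
  refine ⟨p, hp, hpj, fun q hq hqj => ?_⟩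
  refine nonneg_of_mul_nonneg_right ?_ (K.side_pred_vertex_succ_pos j)
  rw [side_pred_mul_cross_sight]
  linarith [hmin q hq hqj]

theorem exists_extremeL (hP : IsCompact P) (hj : K.EdgeSeen P j)
    (hpred : ¬ K.EdgeSeen P (j - 1)) :
    ∃ p ∈ P, K.SeesEdge p j ∧
      ∀ q ∈ P, K.SeesEdge q j → cross (K.vertex j - q) (K.vertex j - p) ≤ 0 := by
  simp only [seesEdge_iff]
  obtain ⟨p, hp, hpj, hmin⟩ := exists_isMinOn_ratio hP (K.continuous_side j)
    (K.continuous_side (j - 1)) (K.edgeSeen_iff.1 hj) (K.not_edgeSeen_iff.1 hpred)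
  refine ⟨p, hp, hpj, fun q hq hqj => ?_⟩
  refine nonpos_of_mul_nonpos_right ?_ (K.side_pred_vertex_succ_pos j)
  rw [side_pred_mul_cross_sight]
  linarith [hmin q hq hqj]

variable (K) in
theorem exists_isScope (hP : IsCompact P) (hne : P.Nonempty) (hF : P ⊆ K.free)
    (hfin : ¬ K.Finished P) : ∃ σ, K.IsScope P σ := by
  obtain ⟨x, hx⟩ := hne
  obtain ⟨i, hi⟩ := K.mem_free.1 (hF hx)
  have hseen : K.EdgeSeen P i := K.edgeSeen_iff.2 ⟨x, hx, hi⟩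
  obtain ⟨j, hunseen⟩ := not_forall.1 hfin
  obtain ⟨R, hR, hR'⟩ := exists_pred_and_not hseen hunseen
  obtain ⟨L, hL, hL'⟩ := exists_and_not_pred hseen hunseen
  obtain ⟨pR, hpR, hseesR, hextremeR⟩ := exists_extremeR hP hR hR'
  obtain ⟨pL, hpL, hseesL, hextremeL⟩ := exists_extremeL hP hL hL'
  exact ⟨⟨R, L, pR, pL⟩, hR, hR', hL, hL', hpR, hseesR, hextremeR, hpL, hseesL, hextremeL⟩

end ScopeExistence

section ClosingTarget

variable {p q : ℂ} {i j k : ZMod K.n} {σ : K.Scope}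

variable (K) in
/-- The point `p` lies in the relative interior of an edge. From such a point, if the edge is
parallel to `m`, no point of the line of `m` outside of `m` is visible, so that the approach of the
far side would get stuck. -/
def InEdgeInterior (p : ℂ) : Prop := ∃ i, K.side i p = 0 ∧ ∀ j, j ≠ i → 0 < K.side j p

variable (K) in
theorem isClosed_visible (p : ℂ) : IsClosed {q | K.Visible p q} := by
  have hinter : {q | K.Visible p q} =
      ⋂ t ∈ Icc (0 : ℝ) 1, (fun q => AffineMap.lineMap p q t) ⁻¹' K.free := by
    ext q
    simp only [mem_ofPred_eq, visible_iff_segment_subset_free, segment_eq_image_lineMap,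
      image_subset_iff, mem_iInter, mem_preimage]
    rfl
  rw [hinter]
  refine isClosed_biInter fun t _ => K.isClosed_free.preimage ?_
  simp only [AffineMap.lineMap_apply_module]
  fun_prop

theorem exists_isClosestFree {A : Set ℂ} (hA : IsClosed A) (hq : q ∈ A) (hv : K.Visible p q) :
    ∃ q', K.IsClosestFree A p q' := by
  obtain ⟨q', hq', hd⟩ := (hA.inter (K.isClosed_visible p)).exists_infDist_eq_dist ⟨q, hq, hv⟩ p
  exact ⟨q', hq'.1, hq'.2, fun y hy hyv => hd ▸ Metric.infDist_le_dist_of_mem ⟨hy, hyv⟩⟩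

theorem exists_visible_lineMap {a b : ℂ} (hp : K.side i p < 0) (ha : 0 ≤ K.side i a)
    (hside : K.side i a = K.side i b) (hab : a ≠ b) :
    ∃ t : ℝ, 1 ≤ t ∧ K.Visible p (AffineMap.lineMap a b t) := by
  obtain ⟨M, hM⟩ := K.isBounded_obstacle.exists_norm_le
  set g : ℂ → ℝ := fun x => inner ℝ (b - a) x with hg
  -- A point of the segment in the half-plane of the polygon divides it at a ratio `l > r`.
  set r := -K.side i p / (K.side i a - K.side i p) with hr
  have hrpos : 0 < r := div_pos (neg_pos.2 hp) (by linarith)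
  have hnorm : 0 < ‖b - a‖ ^ 2 := pow_pos (norm_pos_iff.2 (sub_ne_zero.2 hab.symm)) 2
  have htop : Tendsto (fun t : ℝ => r * (t * ‖b - a‖ ^ 2)) atTop atTop :=
    (tendsto_id.atTop_mul_const hnorm).const_mul_atTop hrpos
  obtain ⟨t, ht, hlarge⟩ := ((eventually_ge_atTop 1).and
    (htop.eventually_gt_atTop (|g p| + |g a| + ‖b - a‖ * M))).exists
  refine ⟨t, ht, visible_iff_segment_subset_free.2 fun z hz hzO => ?_⟩
  rw [segment_eq_image_lineMap] at hz
  obtain ⟨l, ⟨hl0, hl1⟩, rfl⟩ := hz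
  have hside' : K.side i (AffineMap.lineMap a b t) = K.side i a := by
    rw [affineMap_lineMap_eq, ← hside]; ring
  have hlr : r < l := by
    have hpos := K.mem_obstacle.1 hzO i
    rw [affineMap_lineMap_eq, hside'] at hpos
    rw [hr, div_lt_iff₀ (by linarith)]
    linarith
  have hgz : g (AffineMap.lineMap p (AffineMap.lineMap a b t) l) =
      (1 - l) * g p + l * g a + l * (t * ‖b - a‖ ^ 2) := by
    simp only [hg, AffineMap.lineMap_apply_module', inner_add_right, real_inner_smul_right,
      inner_sub_right, ← real_inner_self_eq_norm_sq]
    ring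
  have hgle := (real_inner_le_norm (b - a) _).trans
    (mul_le_mul_of_nonneg_left (hM _ hzO) (norm_nonneg (b - a)))
  have hlt := mul_lt_mul_of_pos_right hlr (mul_pos (one_pos.trans_le ht) hnorm)
  have hgp : -|g p| ≤ (1 - l) * g p := by
    nlinarith [neg_abs_le (g p), abs_nonneg (g p)]
  have hga : -|g a| ≤ l * g a := by
    nlinarith [neg_abs_le (g a), abs_nonneg (g a)]
  linarith [hgz.symm.trans_le hgle]

theorem side_pos_of_parallel (hij : i ≠ j) (hp : K.side i p = 0)
    (hpar : cross (K.vertex (i + 1) - K.vertex i) (K.vertex (j + 1) - K.vertex j) = 0) :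
    0 < K.side j p := by
  have hparp : cross (K.vertex (i + 1) - K.vertex i) (p - K.mid i) = 0 := by
    rw [← signedArea_sub]
    exact sub_eq_zero.2 (hp.trans (K.side_mid_self i).symm)
  have hsub : K.side j p - K.side j (K.mid i) = 0 := (signedArea_sub _ _ _ _).trans <|
    cross_eq_zero_trans (sub_ne_zero.2 (K.vertex_ne_vertex_succ i).symm) hpar hparp
  rw [sub_eq_zero.1 hsub]
  exact K.side_mid_pos hij.symm

theorem exists_visible_outerRay (hp : p ∈ K.free) (hint : ¬ K.InEdgeInterior p)
    (hjk : K.vertex j ≠ K.vertex k) :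
    ∃ q, (q ∈ outerRay (K.vertex j) (K.vertex k) ∨ q ∈ outerRay (K.vertex k) (K.vertex j)) ∧
      K.Visible p q := by
  have hcross {l : ZMod K.n} (h : K.side l (K.vertex j) = K.side l (K.vertex k)) :
      cross (K.vertex k - K.vertex j) (K.vertex (l + 1) - K.vertex l) = 0 := by
    rw [cross_swap, ← signedArea_sub]
    exact neg_eq_zero.2 (sub_eq_zero.2 h.symm)
  -- A line that is not parallel to an edge facing `p` leaves the half-plane of this edge.
  have hexists {l : ZMod K.n} (hl : K.side l p ≤ 0)
      (hne : K.side l (K.vertex j) ≠ K.side l (K.vertex k)) :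
      ∃ q, (q ∈ outerRay (K.vertex j) (K.vertex k) ∨ q ∈ outerRay (K.vertex k) (K.vertex j)) ∧
        K.Visible p q := by
    obtain ⟨q, hq, hq0⟩ := exists_mem_outerRay_eq_zero (K.side l) (K.side_vertex_nonneg l j)
      (K.side_vertex_nonneg l k) hne
    exact ⟨q, hq, K.visible_of_side_nonpos hl hq0.le⟩
  obtain ⟨i, hi⟩ := K.mem_free.1 hp
  by_cases hside : K.side i (K.vertex j) = K.side i (K.vertex k)
  · obtain hneg | hzero := hi.lt_or_eq
    · obtain ⟨t, ht, hv⟩ := exists_visible_lineMap hneg (K.side_vertex_nonneg i j) hside hjk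
      exact ⟨_, Or.inr (lineMap_mem_outerRay_swap ht), hv⟩
    obtain ⟨i', hi', hp'⟩ : ∃ i', i' ≠ i ∧ K.side i' p ≤ 0 := by
      by_contra! hpos
      exact hint ⟨i, hzero, hpos⟩
    refine hexists hp' fun hside' => hp'.not_gt (side_pos_of_parallel hi'.symm hzero ?_)
    exact cross_eq_zero_trans (sub_ne_zero.2 hjk.symm) (hcross hside) (hcross hside')
  · exact hexists hi hside

theorem IsScope.exists_isClosingTarget {P : Set ℂ} (hσ : K.IsScope P σ) (hp : p ∈ K.free)
    (hint : ¬ K.InEdgeInterior p) : ∃ q, K.IsClosingTarget σ p q := by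
  by_cases hfoot : ∃ q, K.IsFreeFoot σ p q
  · exact hfoot.imp fun q => Or.inl
  obtain ⟨q, hq | hq, hv⟩ :=
    exists_visible_outerRay hp hint (sub_ne_zero.1 hσ.vL_sub_vR_ne_zero).symm
  · obtain ⟨q', hq'⟩ := exists_isClosestFree (isClosed_outerRay _ _) hq hv
    exact ⟨q', Or.inr ⟨not_exists.1 hfoot, Or.inl hq'⟩⟩
  · obtain ⟨q', hq'⟩ := exists_isClosestFree (isClosed_outerRay _ _) hq hv
    exact ⟨q', Or.inr ⟨not_exists.1 hfoot, Or.inr hq'⟩⟩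

theorem IsClosingTarget.visible (h : K.IsClosingTarget σ p q) : K.Visible p q := by
  obtain h | ⟨-, h | h⟩ := h
  exacts [h.2.2, h.2.1, h.2.1]

theorem IsClosingTarget.mem_outerRay (h : K.IsClosingTarget σ p q) :
    q ∈ outerRay σ.vR σ.vL ∨ q ∈ outerRay σ.vL σ.vR := by
  obtain h | ⟨-, h | h⟩ := h
  exacts [h.1, Or.inl h.1, Or.inr h.1]

theorem side_nonpos_of_mem_outerRay (hi : K.side i (K.vertex j) = 0)
    (hq : q ∈ outerRay (K.vertex j) (K.vertex k)) : K.side i q ≤ 0 := by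
  obtain ⟨t, ht, rfl⟩ := hq
  have hlineMap : K.vertex j + t • (K.vertex j - K.vertex k) =
      AffineMap.lineMap (K.vertex j) (K.vertex k) (-t) := by
    rw [AffineMap.lineMap_apply_module']; module
  rw [hlineMap, affineMap_lineMap_eq, hi, mul_zero, zero_add, neg_mul, neg_nonpos]
  exact mul_nonneg ht (K.side_vertex_nonneg i k)

theorem not_inEdgeInterior_of_mem_outerRay (hq : q ∈ outerRay (K.vertex j) (K.vertex k)) :
    ¬ K.InEdgeInterior q := by
  rintro ⟨i, -, hi⟩
  obtain rfl | hij := eq_or_ne j i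
  · exact (hi (j - 1) (K.pred_ne j)).not_ge (side_nonpos_of_mem_outerRay (by simp) hq)
  · exact (hi j hij).not_ge (side_nonpos_of_mem_outerRay (by simp) hq)

theorem IsClosingTarget.exists_unseen_edge {P : Set ℂ} (hσ : K.IsScope P σ)
    (h : K.IsClosingTarget σ p q) : ∃ i, ¬ K.EdgeSeen P i ∧ K.side i q ≤ 0 := by
  obtain h | h := h.mem_outerRay
  · exact ⟨σ.R, hσ.unseenR, side_nonpos_of_mem_outerRay (by simp) h⟩
  · exact ⟨σ.L - 1, hσ.unseenL, side_nonpos_of_mem_outerRay (by simp) h⟩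

theorem IsClosingTarget.not_inEdgeInterior (h : K.IsClosingTarget σ p q) :
    ¬ K.InEdgeInterior q :=
  h.mem_outerRay.elim not_inEdgeInterior_of_mem_outerRay not_inEdgeInterior_of_mem_outerRay

end ClosingTarget

section StopAt

variable {P : Set ℂ} {σ : K.Scope} {θ : ℝ}

variable (K) in
/-- The exploration is finished, or the scope is at most `θ`: the common form of the two stopping
conditions of the searches. -/
def StopAt (θ : ℝ) (P : Set ℂ) : Prop := K.Finished P ∨ ∃ σ, K.IsScope P σ ∧ σ.angle ≤ θ

theorem StopAt.mono {θ' : ℝ} (h : θ ≤ θ') (hP : K.StopAt θ P) : K.StopAt θ' P :=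
  hP.imp_right fun ⟨σ, hσ, hθ⟩ => ⟨σ, hσ, hθ.trans h⟩

theorem not_stopAt_of_lt (hP : IsPreconnected P) (hF : P ⊆ K.free) (hσ : K.IsScope P σ)
    (h : θ < σ.angle) : ¬ K.StopAt θ P := by
  rintro (hf | ⟨σ', hσ', h'⟩)
  · exact hσ.not_finished hf
  · exact (h.trans_le ((hσ.angle_eq hP hF hσ').trans_le h')).false

theorem IsScope.of_tendsto {ι : Type*} {l : Filter ι} [l.NeBot] {P' : ι → Set ℂ}
    (hsub : ∀ k, P ⊆ P' k) {pR pL : ι → ℂ}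
    (h : ∀ k, K.IsScope (P' k) ⟨σ.R, σ.L, pR k, pL k⟩) (hR : Tendsto pR l (𝓝 σ.pR))
    (hL : Tendsto pL l (𝓝 σ.pL)) (hRP : σ.pR ∈ P) (hLP : σ.pL ∈ P) : K.IsScope P σ := by
  have hseesR : K.SeesEdge σ.pR (σ.R - 1) := K.seesEdge_iff.2 <|
    le_of_tendsto' (((K.continuous_side _).tendsto _).comp hR) fun k => (h k).side_pR_nonpos
  have hseesL : K.SeesEdge σ.pL σ.L := K.seesEdge_iff.2 <|
    le_of_tendsto' (((K.continuous_side _).tendsto _).comp hL) fun k => (h k).side_pL_nonpos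
  have hcont (v q : ℂ) : Continuous fun z => cross (v - q) (v - z) :=
    continuous_cross continuous_const (by fun_prop)
  obtain ⟨k⟩ := l.nonempty_of_neBot
  exact ⟨⟨_, hRP, hseesR⟩, fun hseen => (h k).unseenR (hseen.mono (hsub k)), ⟨_, hLP, hseesL⟩,
    fun hseen => (h k).unseenL (hseen.mono (hsub k)), hRP, hseesR,
    fun q hq hqR => ge_of_tendsto' (((hcont σ.vR q).tendsto _).comp hR)
      fun k => (h k).extremeR q (hsub k hq) hqR, hLP, hseesL,
    fun q hq hqL => le_of_tendsto' (((hcont σ.vL q).tendsto _).comp hL)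
      fun k => (h k).extremeL q (hsub k hq) hqL⟩

theorem IsScope.angle_le_of_tendsto (hσ : K.IsScope P σ) (hθ : θ ≤ Real.pi / 2) {ι : Type*}
    {l : Filter ι} [l.NeBot] {P' : ι → Set ℂ} (hsub : ∀ k, P ⊆ P' k) {pR pL : ι → ℂ}
    (h : ∀ k, K.IsScope (P' k) ⟨σ.R, σ.L, pR k, pL k⟩) (hR : Tendsto pR l (𝓝 σ.pR))
    (hL : Tendsto pL l (𝓝 σ.pL))
    (hangle : ∀ k, (⟨σ.R, σ.L, pR k, pL k⟩ : K.Scope).angle ≤ θ) : σ.angle ≤ θ :=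
  arg_le_of_tendsto (u := fun k => σ.vR - pR k) (v := fun k => σ.vL - pL k) hθ hσ.uR_ne_zero
    hσ.uL_ne_zero (hR.const_sub _) (hL.const_sub _)
    (fun k => (h k).extremeR _ (hsub k hσ.memR) hσ.seesR)
    (fun k => (h k).extremeL _ (hsub k hσ.memL) hσ.seesL) hangle

variable {f : ℝ → ℂ} {T : ℝ}

theorem edgeSeen_of_tendsto (hf : ContinuousOn f (Ici 0)) {u : ℕ → ℝ}
    (hu : Tendsto u atTop (𝓝 T)) {i : ZMod K.n} (h : ∀ k, K.EdgeSeen (f '' Icc 0 (u k)) i) :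
    K.EdgeSeen (f '' Icc 0 T) i := by
  simp only [edgeSeen_iff] at h ⊢
  choose p hp hside using h
  obtain ⟨x, hx, φ, -, hlim⟩ := exists_tendsto_subseq_image_Icc hf hu hp
  exact ⟨x, hx, le_of_tendsto' (((K.continuous_side i).tendsto _).comp hlim)
    fun k => hside (φ k)⟩

theorem exists_isScope_of_tendsto (hf : ContinuousOn f (Ici 0)) {u : ℕ → ℝ}
    (hu : Tendsto u atTop (𝓝 T)) (hT : ∀ k, T ≤ u k) (hθ : θ ≤ Real.pi / 2) {R L : ZMod K.n}
    (h : ∀ k, ∃ pR pL, K.IsScope (f '' Icc 0 (u k)) ⟨R, L, pR, pL⟩ ∧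
      (⟨R, L, pR, pL⟩ : K.Scope).angle ≤ θ) :
    ∃ σ, K.IsScope (f '' Icc 0 T) σ ∧ σ.angle ≤ θ := by
  choose pR pL hσ hangle using h
  obtain ⟨x, hx, φ, hφ, hlimR⟩ := exists_tendsto_subseq_image_Icc hf hu fun k => (hσ k).memR
  obtain ⟨y, hy, ψ, hψ, hlimL⟩ := exists_tendsto_subseq_image_Icc hf (hu.comp hφ.tendsto_atTop)
    fun k => (hσ (φ k)).memL
  have hlimR' := hlimR.comp hψ.tendsto_atTop
  have hsub (k : ℕ) : f '' Icc 0 T ⊆ f '' Icc 0 (u (φ (ψ k))) :=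
    image_mono (Icc_subset_Icc_right (hT _))
  have hscope : K.IsScope (f '' Icc 0 T) ⟨R, L, x, y⟩ :=
    IsScope.of_tendsto hsub (fun k => hσ (φ (ψ k))) hlimR' hlimL hx hy
  exact ⟨_, hscope, hscope.angle_le_of_tendsto hθ hsub (fun k => hσ (φ (ψ k))) hlimR' hlimL
    fun k => hangle (φ (ψ k))⟩

theorem stopAt_of_tendsto (hf : ContinuousOn f (Ici 0)) {u : ℕ → ℝ} (hu : Tendsto u atTop (𝓝 T))
    (hT : ∀ k, T ≤ u k) (hθ : θ ≤ Real.pi / 2) (h : ∀ k, K.StopAt θ (f '' Icc 0 (u k))) :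
    K.StopAt θ (f '' Icc 0 T) := by
  -- One of the finitely many cases (finished, or extreme vertices `R` and `L`) occurs frequently.
  obtain hfreq | hfreq := frequently_or_distrib.1 (Frequently.of_forall (f := atTop) h)
  · obtain ⟨φ, hφ, hfin⟩ := extraction_of_frequently_atTop hfreq
    exact Or.inl fun i =>
      edgeSeen_of_tendsto hf (hu.comp hφ.tendsto_atTop) fun k => hfin k i
  have hfreq' : ∃ RL : ZMod K.n × ZMod K.n, ∃ᶠ k in atTop, ∃ pR pL,
      K.IsScope (f '' Icc 0 (u k)) ⟨RL.1, RL.2, pR, pL⟩ ∧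
        (⟨RL.1, RL.2, pR, pL⟩ : K.Scope).angle ≤ θ := by
    simp only [Filter.Frequently, ← not_forall, ← eventually_all]
    refine fun hno => hfreq (hno.mono ?_)
    rintro k hk ⟨⟨R, L, pR, pL⟩, hσ⟩
    exact hk (R, L) ⟨pR, pL, hσ⟩
  obtain ⟨⟨R, L⟩, hRL⟩ := hfreq'
  obtain ⟨φ, hφ, hscope⟩ := extraction_of_frequently_atTop hRL
  exact Or.inr <|
    exists_isScope_of_tendsto hf (hu.comp hφ.tendsto_atTop) (fun k => hT _) hθ hscope

theorem exists_isLeast_stopAt (hf : ContinuousOn f (Ici 0)) (hθ : θ ≤ Real.pi / 2)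
    (hne : ∃ r, 0 ≤ r ∧ K.StopAt θ (f '' Icc 0 (T + r))) :
    ∃ τ, IsLeast {r | 0 ≤ r ∧ K.StopAt θ (f '' Icc 0 (T + r))} τ := by
  set S := {r | 0 ≤ r ∧ K.StopAt θ (f '' Icc 0 (T + r))}
  have hbdd : BddBelow S := ⟨0, fun r hr => hr.1⟩
  obtain ⟨u, -, hlim, hu⟩ := exists_seq_tendsto_sInf (S := S) hne hbdd
  refine ⟨sInf S, ⟨le_csInf hne fun r hr => hr.1, ?_⟩, fun r hr => csInf_le hbdd hr⟩
  exact stopAt_of_tendsto hf (hlim.const_add T)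
    (fun k => add_le_add_right (csInf_le hbdd (hu k)) T) hθ fun k => (hu k).2

end StopAt

end ConvexPolygon

/-! ### Points in edges and far away -/

theorem mul_cross_le_inner_mul_cross {e a b : ℂ} (h : 0 ≤ cross a b) :
    cross e a * inner ℝ e b ≤ inner ℝ e a * cross e b := by
  have hid : inner ℝ e a * cross e b - cross e a * inner ℝ e b = Complex.normSq e * cross a b := by
    rw [inner_eq, inner_eq, Complex.normSq_apply]; simp only [cross]; ring
  exact sub_nonneg.1 (hid ▸ mul_nonneg (Complex.normSq_nonneg e) h)

theorem arg_div_le_neg_pi_div_two {a b : ℂ} (hcross : cross a b < 0) (hinner : inner ℝ a b ≤ 0) :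
    Complex.arg (b / a) ≤ -(Real.pi / 2) := by
  have ha : a ≠ 0 := by rintro rfl; simp at hcross
  have hN := Complex.normSq_pos.2 ha
  have him : (b / a).im < 0 := by rw [im_div_eq]; exact div_neg_of_neg_of_pos hcross hN
  have hre : (b / a).re ≤ 0 := by
    rw [Complex.div_re, ← add_div, mul_comm b.re, mul_comm b.im, ← inner_eq]
    exact div_nonpos_of_nonpos_of_nonneg hinner hN.le
  have habs : ¬ |Complex.arg (b / a)| < Real.pi / 2 := by
    rw [Complex.abs_arg_lt_pi_div_two_iff, not_or]
    exact ⟨hre.not_gt, fun h => by simp [h] at him⟩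
  rw [abs_of_neg (Complex.arg_neg_iff.2 him)] at habs
  linarith

theorem arg_div_le_of_cross_neg {e a b : ℂ} (ha : cross e a < 0) (ha' : -cross e a ≤ inner ℝ e a)
    (hb : cross e b < 0) (hb' : inner ℝ e b ≤ cross e b) :
    Complex.arg (b / a) ≤ -(Real.pi / 2) := by
  have he : 0 < Complex.normSq e := Complex.normSq_pos.2 (by rintro rfl; simp at ha)
  have hcross : Complex.normSq e * cross a b =
      inner ℝ e a * cross e b - cross e a * inner ℝ e b := by
    rw [inner_eq, inner_eq, Complex.normSq_apply]; simp only [cross]; ring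
  have hinner : Complex.normSq e * inner ℝ a b =
      inner ℝ e a * inner ℝ e b + cross e a * cross e b := by
    rw [inner_eq, inner_eq, inner_eq, Complex.normSq_apply]; simp only [cross]; ring
  refine arg_div_le_neg_pi_div_two (neg_of_mul_neg_right (hcross ▸ ?_) he.le)
    (nonpos_of_mul_nonpos_right (hinner ▸ ?_) he) <;> nlinarith

section Far

variable {a b e w x : ℂ}

theorem tendsto_signedArea_add_smul (h : 0 < cross (b - a) w) :
    Tendsto (fun r : ℝ => signedArea a b (x + r • w)) atTop atTop := by
  simp only [signedArea_add_smul]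
  exact tendsto_atTop_add_const_left _ _ (tendsto_id.atTop_mul_const h)

theorem tendsto_signedArea_sub_smul (h : 0 < cross (b - a) w) :
    Tendsto (fun r : ℝ => signedArea a b (x - r • w)) atTop atBot := by
  simp only [sub_eq_add_neg, ← neg_smul, signedArea_add_smul]
  exact tendsto_atBot_add_const_left _ _ (tendsto_neg_atTop_atBot.atBot_mul_const h)

theorem eventually_signedArea_mul_neg (h : cross (b - a) w ≠ 0) :
    ∀ᶠ T : ℝ in atTop, ∀ r ≥ T, ∀ r' ≥ T,
      signedArea a b (x + r • w) * signedArea a b (x - r' • w) < 0 := by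
  wlog hpos : 0 < cross (b - a) w generalizing a b
  · have hba : cross (a - b) w = -cross (b - a) w := by rw [← neg_sub, cross_neg_left]
    simpa only [signedArea_swap a b, neg_mul_neg] using this (a := b) (b := a) (by simpa [hba])
      (by rw [hba, neg_pos]; exact h.lt_of_le (not_lt.1 hpos))
  filter_upwards [eventually_forall_ge_atTop.2 <|
      (tendsto_signedArea_add_smul hpos).eventually_gt_atTop 0,
    eventually_forall_ge_atTop.2 <| (tendsto_signedArea_sub_smul hpos).eventually_lt_atBot 0]
    with T hT hT' r hr r' hr'
  exact mul_neg_of_pos_of_neg (hT r hr) (hT' r' hr')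

theorem tendsto_inner_sub_sub_smul (he : e ≠ 0) (v p : ℂ) :
    Tendsto (fun r : ℝ => inner ℝ e (v - (p - r • e))) atTop atTop := by
  have h (r : ℝ) : inner ℝ e (v - (p - r • e)) = inner ℝ e (v - p) + r * inner ℝ e e := by
    rw [sub_sub_eq_add_sub, add_sub_right_comm, inner_add_right, inner_smul_right]
  simp only [h]
  exact tendsto_atTop_add_const_left _ _ (tendsto_id.atTop_mul_const (real_inner_self_pos.2 he))

theorem cross_sub_sub_smul (e v p : ℂ) (r : ℝ) : cross e (v - (p - r • e)) = cross e (v - p) := by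
  rw [sub_sub_eq_add_sub, add_sub_right_comm, ← sub_neg_eq_add, cross_sub_right, cross_neg_right,
    cross_smul_right, cross_self]
  simp

end Far

namespace ConvexPolygon

variable {K : ConvexPolygon}

section EdgeInterior

variable {P P' : Set ℂ} {σ : K.Scope} {p x y : ℂ} {f : ℝ → ℂ} {T S θ : ℝ}

theorem InEdgeInterior.eventually_side_nonpos (h : K.InEdgeInterior p) :
    ∀ᶠ x in 𝓝[K.free] p, ∀ j, K.side j p ≤ 0 → K.side j x ≤ 0 := by
  obtain ⟨i, -, hpos⟩ := h
  have hnear : ∀ᶠ x in 𝓝 p, ∀ j, j ≠ i → 0 < K.side j x := eventually_all.2 fun j =>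
    eventually_imp_distrib_left.2 fun hj =>
      (K.continuous_side j).continuousAt.eventually_const_lt (hpos j hj)
  filter_upwards [hnear.filter_mono nhdsWithin_le_nhds, self_mem_nhdsWithin] with x hx hfree j hj
  obtain rfl : j = i := by_contra fun hji => (hpos j hji).not_ge hj
  obtain ⟨k, hk⟩ := K.mem_free.1 hfree
  obtain rfl : k = j := by_contra fun hkj => (hx k hkj).not_ge hk
  exact hk

theorem InEdgeInterior.side_nonneg (h : K.InEdgeInterior p) (j : ZMod K.n) : 0 ≤ K.side j p := by
  obtain ⟨i, hi, hpos⟩ := h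
  obtain rfl | hj := eq_or_ne j i
  exacts [hi.ge, (hpos j hj).le]

theorem IsScope.exists_sight_eq_smul_uR (hσ : K.IsScope P σ) (h : 0 ≤ K.side (σ.R - 1) σ.pR)
    (hx : x ∈ P) (hsees : K.side (σ.R - 1) x ≤ 0) : ∃ c : ℝ, 0 < c ∧ σ.vR - x = c • σ.uR := by
  have hxR := K.not_edgeSeen_iff.1 hσ.unseenR x hx
  refine exists_pos_smul_eq_of_cross_eq_zero (K.side σ.R) (K.side_vertex σ.R) hσ.side_pR_pos hxR
    (le_antisymm ?_ (nonneg_of_mul_nonneg_right ?_ (K.side_pred_vertex_succ_pos σ.R)))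
  · rw [cross_swap, neg_nonpos]
    exact hσ.extremeR x hx (K.seesEdge_iff.2 hsees)
  · rw [Scope.vR, K.side_pred_mul_cross_sight]
    nlinarith [mul_nonneg h hxR.le, mul_nonneg hσ.side_pR_pos.le (neg_nonneg.2 hsees)]

theorem IsScope.exists_sight_eq_smul_uL (hσ : K.IsScope P σ) (h : 0 ≤ K.side σ.L σ.pL)
    (hx : x ∈ P) (hsees : K.side σ.L x ≤ 0) : ∃ c : ℝ, 0 < c ∧ σ.vL - x = c • σ.uL := by
  have hxL := K.not_edgeSeen_iff.1 hσ.unseenL x hx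
  refine exists_pos_smul_eq_of_cross_eq_zero (K.side (σ.L - 1))
    (by rw [Scope.vL, side_pred_vertex]) hσ.side_pL_pos hxL
    (le_antisymm (nonpos_of_mul_nonpos_right ?_ (K.side_pred_vertex_succ_pos σ.L)) ?_)
  · rw [Scope.vL, K.side_pred_mul_cross_sight]
    nlinarith [mul_nonneg h hxL.le, mul_nonneg hσ.side_pL_pos.le (neg_nonneg.2 hsees)]
  · rw [cross_swap, neg_nonneg]
    exact hσ.extremeL x hx (K.seesEdge_iff.2 hsees)

theorem IsScope.of_sight_eq_smul (hσ : K.IsScope P σ) (hsub : P' ⊆ P) (hx : x ∈ P')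
    (hxR : K.side (σ.R - 1) x ≤ 0) {c : ℝ} (hc : 0 < c) (hcx : σ.vR - x = c • σ.uR) (hy : y ∈ P')
    (hyL : K.side σ.L y ≤ 0) {d : ℝ} (hd : 0 < d) (hdy : σ.vL - y = d • σ.uL) :
    K.IsScope P' ⟨σ.R, σ.L, x, y⟩ where
  seenR := ⟨x, hx, K.seesEdge_iff.2 hxR⟩
  unseenR h := hσ.unseenR (h.mono hsub)
  seenL := ⟨y, hy, K.seesEdge_iff.2 hyL⟩
  unseenL h := hσ.unseenL (h.mono hsub)
  memR := hx
  seesR := K.seesEdge_iff.2 hxR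
  extremeR q hq hsees := by
    change 0 ≤ cross (σ.vR - q) (σ.vR - x)
    rw [hcx, cross_smul_right]
    exact mul_nonneg hc.le (hσ.extremeR q (hsub hq) hsees)
  memL := hy
  seesL := K.seesEdge_iff.2 hyL
  extremeL q hq hsees := by
    change cross (σ.vL - q) (σ.vL - y) ≤ 0
    rw [hdy, cross_smul_right]
    exact mul_nonpos_of_nonneg_of_nonpos hd.le (hσ.extremeL q (hsub hq) hsees)

theorem exists_mem_Ioo_side_nonpos (hf : ContinuousOn f (Icc 0 S)) (hT : 0 ≤ T) (hTS : T < S)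
    (hF : MapsTo f (Icc 0 S) K.free) (hint : K.InEdgeInterior (f S)) :
    ∃ u ∈ Ioo T S, ∀ j, K.side j (f S) ≤ 0 → K.side j (f u) ≤ 0 := by
  have hlim : Tendsto f (𝓝[Ioo T S] S) (𝓝[K.free] (f S)) :=
    ((hf S ⟨hT.trans hTS.le, le_rfl⟩).tendsto_nhdsWithin hF).mono_left
      (nhdsWithin_mono _ fun u hu => ⟨hT.trans hu.1.le, hu.2.le⟩)
  have : (𝓝[Ioo T S] S).NeBot := by
    rw [nhdsWithin_Ioo_eq_nhdsLT hTS]; infer_instance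
  obtain ⟨u, hu, hmem⟩ :=
    ((hlim.eventually hint.eventually_side_nonpos).and self_mem_nhdsWithin).exists
  exact ⟨u, hmem, hu⟩

-- In the interior of an edge the robot looks along this edge, as it did just before.
theorem IsScope.exists_earlier (hf : ContinuousOn f (Icc 0 S)) (hT : 0 ≤ T) (hTS : T < S)
    (hF : MapsTo f (Icc 0 S) K.free) (hint : K.InEdgeInterior (f S))
    (hσ : K.IsScope (f '' Icc 0 S) σ) :
    ∃ u ∈ Ico T S, ∃ σ', K.IsScope (f '' Icc 0 u) σ' ∧ σ'.angle = σ.angle := by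
  obtain ⟨u₀, ⟨hTu₀, hu₀S⟩, hu₀⟩ := exists_mem_Ioo_side_nonpos hf hT hTS hF hint
  have hmem : f u₀ ∈ f '' Icc 0 S := mem_image_of_mem f ⟨hT.trans hTu₀.le, hu₀S.le⟩
  have hR : ∃ t ∈ Ico 0 S, K.side (σ.R - 1) (f t) ≤ 0 ∧
      ∃ c : ℝ, 0 < c ∧ σ.vR - f t = c • σ.uR := by
    obtain ⟨t, ⟨h0, hS⟩, hft⟩ := hσ.memR
    obtain hlt | rfl := hS.lt_or_eq
    · exact ⟨t, ⟨h0, hlt⟩, hft ▸ hσ.side_pR_nonpos, 1, one_pos, by rw [one_smul, hft, Scope.uR]⟩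
    · have hsees := hu₀ _ (hft ▸ hσ.side_pR_nonpos)
      exact ⟨u₀, ⟨hT.trans hTu₀.le, hu₀S⟩, hsees,
        hσ.exists_sight_eq_smul_uR (hft ▸ hint.side_nonneg _) hmem hsees⟩
  have hL : ∃ t ∈ Ico 0 S, K.side σ.L (f t) ≤ 0 ∧
      ∃ c : ℝ, 0 < c ∧ σ.vL - f t = c • σ.uL := by
    obtain ⟨t, ⟨h0, hS⟩, hft⟩ := hσ.memL
    obtain hlt | rfl := hS.lt_or_eq
    · exact ⟨t, ⟨h0, hlt⟩, hft ▸ hσ.side_pL_nonpos, 1, one_pos, by rw [one_smul, hft, Scope.uL]⟩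
    · have hsees := hu₀ _ (hft ▸ hσ.side_pL_nonpos)
      exact ⟨u₀, ⟨hT.trans hTu₀.le, hu₀S⟩, hsees,
        hσ.exists_sight_eq_smul_uL (hft ▸ hint.side_nonneg _) hmem hsees⟩
  obtain ⟨r, ⟨hr0, hrS⟩, hrR, c, hc, hcr⟩ := hR
  obtain ⟨l, ⟨hl0, hlS⟩, hlL, d, hd, hdl⟩ := hL
  have hlt : max u₀ (max r l) < S := max_lt hu₀S (max_lt hrS hlS)
  refine ⟨max u₀ (max r l), ⟨hTu₀.le.trans (le_max_left _ _), hlt⟩, _,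
    hσ.of_sight_eq_smul (image_mono (Icc_subset_Icc_right hlt.le))
      (mem_image_of_mem f ⟨hr0, le_max_of_le_right (le_max_left _ _)⟩) hrR hc hcr
      (mem_image_of_mem f ⟨hl0, le_max_of_le_right (le_max_right _ _)⟩) hlL hd hdl, ?_⟩
  change Complex.arg ((σ.vL - f l) / (σ.vR - f r)) = Complex.arg (σ.uL / σ.uR)
  rw [hcr, hdl, arg_smul_div_smul hc hd]

theorem not_inEdgeInterior_of_isLeast {τ : ℝ} (hf : ContinuousOn f (Icc 0 (T + τ))) (hT : 0 ≤ T)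
    (hτ : IsLeast {r | 0 ≤ r ∧ K.StopAt θ (f '' Icc 0 (T + r))} τ) (hτ0 : 0 < τ)
    (hF : MapsTo f (Icc 0 (T + τ)) K.free) (hfin : ¬ K.Finished (f '' Icc 0 (T + τ))) :
    ¬ K.InEdgeInterior (f (T + τ)) := by
  intro hint
  obtain ⟨σ, hσ, hangle⟩ := hτ.1.2.resolve_left hfin
  obtain ⟨u, ⟨hTu, hu⟩, σ', hσ', hangle'⟩ := hσ.exists_earlier hf hT (by linarith) hF hint
  have hle : τ ≤ u - T := hτ.2 ⟨sub_nonneg.2 hTu, Or.inr ⟨σ', by rwa [add_sub_cancel],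
    hangle'.trans_le hangle⟩⟩
  linarith

end EdgeInterior

section Far

variable {e w : ℂ} {k : ZMod K.n} {l : ℝ}

variable (K) in
theorem ne_zero_of_vertex_sub_eq_smul (hd : K.vertex (k + 1) - K.vertex k = l • e) : e ≠ 0 := by
  rintro rfl
  rw [smul_zero, sub_eq_zero] at hd
  exact K.vertex_ne_vertex_succ k hd.symm

theorem eventually_le_inner_uR (p : ℂ) (hl : 0 < l)
    (hd : K.vertex (k + 1) - K.vertex k = l • e) :
    ∀ᶠ r : ℝ in atTop, ∀ P σ, K.IsScope P σ → σ.R = k → p - r • e ∈ P →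
      cross e σ.uR < 0 ∧ -cross e σ.uR ≤ inner ℝ e σ.uR := by
  have hturn : 0 < cross (K.vertex k - K.vertex (k - 1)) e := by
    have h := K.side_pred_vertex_succ_pos k
    rw [side_pred, signedArea_eq_cross_sub_right, hd, cross_smul_right] at h
    exact pos_of_mul_pos_right h hl.le
  filter_upwards [(tendsto_signedArea_sub_smul (x := p) hturn).eventually_le_atBot 0,
    (tendsto_inner_sub_sub_smul (K.ne_zero_of_vertex_sub_eq_smul hd) (K.vertex k)
      p).eventually_ge_atTop (-cross e (K.vertex k - p))] with r hsees hinner P σ hσ hR hr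
  subst hR
  have hneg {x : ℂ} (hx : x ∈ P) : cross e (σ.vR - x) < 0 := by
    have h := K.not_edgeSeen_iff.1 hσ.unseenR x hx
    rw [side, signedArea_apply, hd, ← neg_sub, cross_neg_right, cross_smul_left] at h
    exact neg_of_mul_neg_right (neg_pos.1 h) hl.le
  have hfar := hneg hr
  have hextreme := mul_cross_le_inner_mul_cross (e := e)
    (hσ.extremeR _ hr (K.seesEdge_iff.2 (by rwa [side_pred])))
  rw [cross_sub_sub_smul] at hextreme hfar
  refine ⟨hneg hσ.memR, (mul_le_mul_left_of_neg hfar).1 (hextreme.trans ?_)⟩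
  rw [mul_neg, ← neg_mul]
  exact mul_le_mul_of_nonpos_right hinner (hneg hσ.memR).le

theorem eventually_le_inner_uL (p : ℂ) (hl : 0 < l)
    (hd : K.vertex (k - 1) - K.vertex k = l • e) :
    ∀ᶠ r : ℝ in atTop, ∀ P σ, K.IsScope P σ → σ.L = k → p - r • e ∈ P →
      0 < cross e σ.uL ∧ cross e σ.uL ≤ inner ℝ e σ.uL := by
  have hd' : K.vertex (k - 1 + 1) - K.vertex (k - 1) = l • -e := by
    rw [sub_add_cancel, smul_neg, ← hd, neg_sub]
  have hturn : 0 < cross (K.vertex (k + 1) - K.vertex k) e := by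
    have h := K.side_pred_vertex_succ_pos k
    rw [side_pred, signedArea_eq_cross_sub_right, ← neg_sub, hd, cross_swap, cross_neg_right,
      neg_neg, cross_smul_right] at h
    exact pos_of_mul_pos_right h hl.le
  filter_upwards [(tendsto_signedArea_sub_smul (x := p) hturn).eventually_le_atBot 0,
    (tendsto_inner_sub_sub_smul (neg_ne_zero.1 (K.ne_zero_of_vertex_sub_eq_smul hd')) (K.vertex k)
      p).eventually_ge_atTop (cross e (K.vertex k - p))] with r hsees hinner P σ hσ hL hr
  subst hL
  have hpos {x : ℂ} (hx : x ∈ P) : 0 < cross e (σ.vL - x) := by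
    have h := K.not_edgeSeen_iff.1 hσ.unseenL x hx
    rw [side_pred, signedArea_eq_cross_sub_right, ← neg_sub, hd, ← neg_sub, cross_neg_right,
      cross_neg_left, neg_neg, cross_smul_left] at h
    exact pos_of_mul_pos_right h hl.le
  have hfar := hpos hr
  have hextreme := mul_cross_le_inner_mul_cross (e := e) (a := σ.uL) (b := σ.vL - (p - r • e))
    (by rw [cross_swap, neg_nonneg]; exact hσ.extremeL _ hr (K.seesEdge_iff.2 hsees))
  rw [cross_sub_sub_smul] at hextreme hfar
  exact ⟨hpos hσ.memL, le_of_mul_le_mul_right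
    ((mul_le_mul_of_nonneg_left hinner (hpos hσ.memL).le).trans hextreme) hfar⟩

theorem eventually_angle_le_of_eq_smul (p : ℂ) (hl : 0 < l)
    (hd : K.vertex (k + 1) - K.vertex k = l • e) :
    ∀ᶠ T : ℝ in atTop, ∀ P σ, K.IsScope P σ → σ.R = k → σ.L = k + 1 → (∃ r ≥ T, p + r • e ∈ P) →
      (∃ r ≥ T, p - r • e ∈ P) → σ.angle ≤ -(Real.pi / 2) := by
  have hd' : K.vertex (k + 1 - 1) - K.vertex (k + 1) = l • -e := by
    rw [add_sub_cancel_right, smul_neg, ← hd, neg_sub]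
  filter_upwards [eventually_forall_ge_atTop.2 (eventually_le_inner_uR p hl hd),
    eventually_forall_ge_atTop.2 (eventually_le_inner_uL p hl hd')]
  rintro T hT hT' P σ hσ hR hL ⟨r', hr', hmem'⟩ ⟨r, hr, hmem⟩
  obtain ⟨hcrossR, hinnerR⟩ := hT r hr P σ hσ hR hmem
  obtain ⟨hcrossL, hinnerL⟩ := hT' r' hr' P σ hσ hL (by simpa using hmem')
  rw [cross_neg_left] at hcrossL hinnerL
  rw [inner_neg_left, neg_le_neg_iff] at hinnerL
  exact arg_div_le_of_cross_neg hcrossR hinnerR (neg_pos.1 hcrossL) hinnerL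

theorem eventually_edgeSeen (p : ℂ) (h : cross (K.vertex (k + 1) - K.vertex k) w ≠ 0) :
    ∀ᶠ T : ℝ in atTop, ∀ P, (∃ r ≥ T, p + r • w ∈ P) → (∃ r ≥ T, p - r • w ∈ P) →
      K.EdgeSeen P k := by
  filter_upwards [eventually_signedArea_mul_neg h]
  rintro T hT P ⟨r, hr, hmem⟩ ⟨r', hr', hmem'⟩
  by_contra hunseen
  rw [not_edgeSeen_iff] at hunseen
  exact (hT r hr r' hr').not_gt (mul_pos (hunseen _ hmem) (hunseen _ hmem'))

theorem eventually_edgeSeen_or {i j : ZMod K.n} (p : ℂ) (hw : w ≠ 0) (hij : i ≠ j) :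
    ∀ᶠ T : ℝ in atTop, ∀ P, IsPreconnected P → P ⊆ K.free → (∃ r ≥ T, p + r • w ∈ P) →
      (∃ r ≥ T, p - r • w ∈ P) → K.EdgeSeen P i ∨ K.EdgeSeen P j := by
  by_cases hpar : cross (K.vertex (i + 1) - K.vertex i) w = 0
  swap
  · filter_upwards [eventually_edgeSeen p hpar] with T hT P _ _ hr hr'
    exact Or.inl (hT P hr hr')
  have hchord : cross (K.mid j - K.mid i) w ≠ 0 := fun h => by
    have hzero : K.side i (K.mid j) - K.side i (K.mid i) = 0 := (signedArea_sub _ _ _ _).trans <|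
      cross_eq_zero_trans hw (by rw [cross_swap, hpar, neg_zero]) (by rw [cross_swap, h, neg_zero])
    rw [side_mid_self, sub_zero] at hzero
    exact (K.side_mid_pos hij).ne' hzero
  filter_upwards [eventually_signedArea_mul_neg hchord]
  rintro T hT P hP hF ⟨r, hr, hmem⟩ ⟨r', hr', hmem'⟩
  by_contra! hunseen
  exact (hT r hr r' hr').not_gt (chord_mul_pos hij hP hF hunseen.1 hunseen.2 hmem hmem')

theorem eventually_angle_le (p : ℂ) (hw : w ≠ 0) (k : ZMod K.n) :
    ∀ᶠ T : ℝ in atTop, ∀ P σ, K.IsScope P σ → σ.R = k → σ.L = k + 1 → (∃ r ≥ T, p + r • w ∈ P) →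
      (∃ r ≥ T, p - r • w ∈ P) → σ.angle ≤ -(Real.pi / 2) := by
  by_cases hpar : cross (K.vertex (k + 1) - K.vertex k) w = 0
  swap
  · filter_upwards [eventually_edgeSeen p hpar]
    rintro T hT P σ hσ rfl - hr hr'
    exact absurd (hT P hr hr') hσ.unseenR
  obtain ⟨l, hl⟩ := exists_eq_smul_of_cross_eq_zero hw (by rw [cross_swap, hpar, neg_zero])
  obtain hneg | rfl | hpos := lt_trichotomy l 0
  · filter_upwards [eventually_angle_le_of_eq_smul p (neg_pos.2 hneg)
      (hl.trans (neg_smul_neg l w).symm)] with T hT P σ hσ hR hL hr hr'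
    exact hT P σ hσ hR hL (by simpa [← sub_eq_add_neg] using hr') (by simpa using hr)
  · rw [zero_smul, sub_eq_zero] at hl
    exact absurd hl.symm (K.vertex_ne_vertex_succ k)
  · exact eventually_angle_le_of_eq_smul p hpos hl

-- All edges are seen but at most one, to which the search is parallel.
theorem eventually_stopAt (p : ℂ) (hw : w ≠ 0) :
    ∀ᶠ T : ℝ in atTop, ∀ P, IsCompact P → IsPreconnected P → P ⊆ K.free →
      (∃ r ≥ T, p + r • w ∈ P) → (∃ r ≥ T, p - r • w ∈ P) → K.StopAt (-(Real.pi / 2)) P := by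
  have hedges : ∀ᶠ T : ℝ in atTop, ∀ ij : ZMod K.n × ZMod K.n, ij.1 ≠ ij.2 → ∀ P,
      IsPreconnected P → P ⊆ K.free → (∃ r ≥ T, p + r • w ∈ P) → (∃ r ≥ T, p - r • w ∈ P) →
        K.EdgeSeen P ij.1 ∨ K.EdgeSeen P ij.2 :=
    eventually_all.2 fun ij => eventually_imp_distrib_left.2 fun h => eventually_edgeSeen_or p hw h
  filter_upwards [hedges, eventually_all.2 (eventually_angle_le (K := K) p hw)]
    with T hedge hangle P hc hP hF hr hr'
  refine or_iff_not_imp_left.2 fun hfin => ?_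
  obtain ⟨σ, hσ⟩ := K.exists_isScope hc (hr.elim fun _ h => ⟨_, h.2⟩) hF hfin
  have hRL : σ.R = σ.L - 1 := by
    by_contra hne
    exact (hedge (σ.R, σ.L - 1) hne P hP hF hr hr').elim hσ.unseenR hσ.unseenL
  exact ⟨σ, hσ, hangle σ.R P σ hσ rfl (by rw [hRL, sub_add_cancel]) hr hr'⟩

end Far

end ConvexPolygon

/-! ### Zigzags -/

section Lipschitz

theorem lipschitzOnWith_of_inter_Iic_of_inter_Ici {E : Type*} [PseudoMetricSpace E] {f : ℝ → E}
    {C : NNReal} {s : Set ℝ} {c : ℝ} (hc : c ∈ s) (h₁ : LipschitzOnWith C f (s ∩ Iic c))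
    (h₂ : LipschitzOnWith C f (s ∩ Ici c)) : LipschitzOnWith C f s := by
  refine LipschitzOnWith.of_dist_le_mul fun a ha b hb => ?_
  wlog hab : a ≤ b generalizing a b
  · rw [dist_comm (f a), dist_comm a]
    exact this b hb a ha (le_of_not_ge hab)
  obtain hbc | hcb := le_total b c
  · exact h₁.dist_le_mul a ⟨ha, hab.trans hbc⟩ b ⟨hb, hbc⟩
  obtain hac | hca := le_total a c
  · calc dist (f a) (f b) ≤ dist (f a) (f c) + dist (f c) (f b) := dist_triangle _ _ _
      _ ≤ C * dist a c + C * dist c b :=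
        add_le_add (h₁.dist_le_mul a ⟨ha, hac⟩ c ⟨hc, self_mem_Iic⟩)
          (h₂.dist_le_mul c ⟨hc, self_mem_Ici⟩ b ⟨hb, hcb⟩)
      _ = C * dist a b := by
        rw [← mul_add, Real.dist_eq, Real.dist_eq, Real.dist_eq, abs_of_nonpos (sub_nonpos.2 hac),
          abs_of_nonpos (sub_nonpos.2 hcb), abs_of_nonpos (sub_nonpos.2 hab)]
        ring
  · exact h₂.dist_le_mul a ⟨ha, hca⟩ b ⟨hb, hcb⟩

theorem lipschitzOnWith_of_hasUnitSpeedOn {E : Type*} [PseudoEMetricSpace E] {f : ℝ → E}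
    {s : Set ℝ} (h : HasUnitSpeedOn f s) : LipschitzOnWith 1 f s := by
  intro a ha b hb
  wlog hab : a ≤ b generalizing a b
  · rw [edist_comm (f a), edist_comm a]
    exact this hb ha (le_of_not_ge hab)
  calc edist (f a) (f b) ≤ eVariationOn f (s ∩ Icc a b) :=
        eVariationOn.edist_le f ⟨ha, left_mem_Icc.2 hab⟩ ⟨hb, right_mem_Icc.2 hab⟩
    _ = (1 : NNReal) * edist a b := by
        rw [h ha hb, ENNReal.coe_one, NNReal.coe_one, one_mul, one_mul, edist_comm, edist_dist,
          Real.dist_eq, abs_of_nonneg (sub_nonneg.2 hab)]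

end Lipschitz

section Zigzag

variable {Q t : ℝ}

theorem zigzag_eq_of_lt (hQ : 0 < Q) {k : ℕ} (h₁ : (2 ^ k - 1) * Q ≤ t)
    (h₂ : t < (2 ^ (k + 1) - 1) * Q) :
    zigzag Q t = (1 - (-2) ^ k) * Q / 3 + (-1) ^ k * (t - (2 ^ k - 1) * Q) := by
  have hk₁ : (2 : ℝ) ^ k ≤ t / Q + 1 := sub_le_iff_le_add.1 ((le_div_iff₀ hQ).2 h₁)
  have hk₂ : t / Q + 1 < (2 : ℝ) ^ (k + 1) := lt_sub_iff_add_lt.1 ((div_lt_iff₀ hQ).2 h₂)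
  have hlog : Nat.log 2 ⌊t / Q + 1⌋₊ = k := by
    refine Nat.log_eq_of_pow_le_of_lt_pow (Nat.le_floor (by exact_mod_cast hk₁)) ?_
    rw [Nat.floor_lt (le_trans (by positivity) hk₁)]
    exact_mod_cast hk₂
  simp only [zigzag, hlog]

theorem zigzag_eq (hQ : 0 < Q) {k : ℕ} (h₁ : (2 ^ k - 1) * Q ≤ t)
    (h₂ : t ≤ (2 ^ (k + 1) - 1) * Q) :
    zigzag Q t = (1 - (-2) ^ k) * Q / 3 + (-1) ^ k * (t - (2 ^ k - 1) * Q) := by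
  obtain h | rfl := h₂.lt_or_eq
  · exact zigzag_eq_of_lt hQ h₁ h
  · rw [zigzag_eq_of_lt hQ le_rfl (by gcongr <;> norm_num), pow_succ (-2 : ℝ), neg_pow (2 : ℝ),
      pow_succ (2 : ℝ)]
    ring

@[simp] theorem zigzag_zero (Q : ℝ) : zigzag Q 0 = 0 := by simp [zigzag]

theorem zigzag_leg (hQ : 0 < Q) (k : ℕ) :
    zigzag Q ((2 ^ k - 1) * Q) = (1 - (-2) ^ k) * Q / 3 := by
  rw [zigzag_eq_of_lt hQ le_rfl (by gcongr <;> norm_num), sub_self, mul_zero, add_zero]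

theorem lipschitzOnWith_zigzag_leg (hQ : 0 < Q) (k : ℕ) :
    LipschitzOnWith 1 (zigzag Q) (Icc ((2 ^ k - 1) * Q) ((2 ^ (k + 1) - 1) * Q)) := by
  refine LipschitzOnWith.of_dist_le_mul fun a ha b hb => ?_
  rw [zigzag_eq hQ ha.1 ha.2, zigzag_eq hQ hb.1 hb.2, dist_add_left, Real.dist_eq, ← mul_sub,
    sub_sub_sub_cancel_right, abs_mul, abs_pow, abs_neg, abs_one, one_pow, NNReal.coe_one,
    Real.dist_eq]

theorem lipschitzOnWith_zigzag_Icc (hQ : 0 < Q) (k : ℕ) :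
    LipschitzOnWith 1 (zigzag Q) (Icc 0 ((2 ^ k - 1) * Q)) := by
  induction k with
  | zero => simp [LipschitzOnWith]
  | succ k ih =>
    have hk : 0 ≤ (2 ^ k - 1) * Q :=
      mul_nonneg (sub_nonneg.2 (one_le_pow₀ one_le_two)) hQ.le
    have hk' : (2 ^ k - 1) * Q ≤ (2 ^ (k + 1) - 1) * Q := by gcongr <;> norm_num
    refine lipschitzOnWith_of_inter_Iic_of_inter_Ici ⟨hk, hk'⟩ ?_ ?_
    · exact ih.mono fun x hx => ⟨hx.1.1, hx.2⟩
    · exact (lipschitzOnWith_zigzag_leg hQ k).mono fun x hx => ⟨hx.2, hx.1.2⟩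

theorem lipschitzOnWith_zigzag (hQ : 0 < Q) : LipschitzOnWith 1 (zigzag Q) (Ici 0) := by
  intro a ha b hb
  obtain ⟨k, hk⟩ := pow_unbounded_of_one_lt (max a b / Q + 1) (one_lt_two (α := ℝ))
  have hk' : max a b ≤ (2 ^ k - 1) * Q := (div_le_iff₀ hQ).1 (by linarith)
  exact lipschitzOnWith_zigzag_Icc hQ k ⟨ha, (le_max_left a b).trans hk'⟩
    ⟨hb, (le_max_right a b).trans hk'⟩

theorem exists_zigzag_eq (hQ : 0 < Q) (y : ℝ) : ∃ t, 0 ≤ t ∧ zigzag Q t = y := by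
  obtain ⟨m, hm⟩ := pow_unbounded_of_one_lt (3 * |y| / Q + 1) (show (1 : ℝ) < 4 by norm_num)
  have hm' : 3 * |y| < (4 ^ m - 1) * Q := (div_lt_iff₀ hQ).1 (lt_sub_iff_add_lt.2 hm)
  have hmem : ∀ k : ℕ, (2 ^ k - 1) * Q ∈ Ici (0 : ℝ) := fun k =>
    mul_nonneg (sub_nonneg.2 (one_le_pow₀ one_le_two)) hQ.le
  have hleft : zigzag Q ((2 ^ (2 * m) - 1) * Q) = (1 - 4 ^ m) * Q / 3 := by
    rw [zigzag_leg hQ, pow_mul]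
    norm_num
  have hright : zigzag Q ((2 ^ (2 * m + 1) - 1) * Q) = (1 + 2 * 4 ^ m) * Q / 3 := by
    rw [zigzag_leg hQ, pow_succ, pow_mul, show (-2 : ℝ) ^ 2 = 4 by norm_num]
    ring
  have hy : y ∈ Icc (zigzag Q ((2 ^ (2 * m) - 1) * Q)) (zigzag Q ((2 ^ (2 * m + 1) - 1) * Q)) := by
    rw [hleft, hright]
    constructor <;> nlinarith [neg_abs_le y, le_abs_self y]
  exact isPreconnected_Ici.intermediate_value (hmem _) (hmem _)
    (lipschitzOnWith_zigzag hQ).continuousOn hy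

end Zigzag

section UnitSpeed

theorem hasUnitSpeedOn_of_isometry {E : Type*} [PseudoEMetricSpace E] {f : ℝ → E}
    (hf : Isometry f) (s : Set ℝ) : HasUnitSpeedOn f s := by
  rw [HasUnitSpeedOn, hasConstantSpeedOnWith_iff_ordered]
  intro x hx y hy hxy
  rw [NNReal.coe_one, one_mul]
  apply le_antisymm
  · calc eVariationOn f (s ∩ Icc x y) ≤ eVariationOn f (Icc x y) :=
          eVariationOn.mono _ inter_subset_right
      _ ≤ (1 : NNReal) * eVariationOn id (Icc x y) :=
          hf.lipschitz.lipschitzOnWith.comp_eVariationOn_le (g := id) (mapsTo_univ _ _)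
      _ = ENNReal.ofReal (y - x) := by rw [eVariationOn_id_Icc, ENNReal.coe_one, one_mul]
  · calc ENNReal.ofReal (y - x) = edist (f x) (f y) := by
          rw [hf.edist_eq, edist_dist, dist_comm, Real.dist_eq, abs_of_nonneg (sub_nonneg.2 hxy)]
      _ ≤ eVariationOn f (s ∩ Icc x y) :=
          eVariationOn.edist_le _ ⟨hx, left_mem_Icc.2 hxy⟩ ⟨hy, right_mem_Icc.2 hxy⟩

variable {E : Type*} [MetricSpace E] {f : ℝ → E}

theorem locallyBoundedVariationOn_of_locallyLipschitz (hf : LocallyLipschitz f) (s : Set ℝ) :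
    LocallyBoundedVariationOn f s := by
  intro a b _ _
  obtain ⟨C, hC⟩ := (hf.locallyLipschitzOn (s := uIcc a b)).exists_lipschitzOnWith_of_compact
    isCompact_uIcc
  exact (hC.locallyBoundedVariationOn a b left_mem_uIcc right_mem_uIcc).mono
    fun x hx => ⟨Icc_subset_uIcc hx.2, hx.2⟩

theorem continuous_variationOnFromTo (hf : LocallyBoundedVariationOn f univ) (hc : Continuous f)
    (a : ℝ) : Continuous (variationOnFromTo f univ a) := by
  refine continuous_iff_continuousAt.2 fun x => continuousAt_iff_continuous_left'_right'.2 ⟨?_, ?_⟩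
  · simpa using! variationOnFromTo.tendsto_left (mem_univ a) (mem_univ x) hf
      (hc.tendsto x |>.mono_left nhdsWithin_le_nhds)
  · simpa using! variationOnFromTo.tendsto_right (mem_univ a) (mem_univ x) hf
      (hc.tendsto x |>.mono_left nhdsWithin_le_nhds)

theorem dist_le_variationOnFromTo (hf : LocallyBoundedVariationOn f univ) {a b : ℝ}
    (hab : a ≤ b) : dist (f a) (f b) ≤ variationOnFromTo f univ a b := by
  rw [variationOnFromTo.eq_of_le _ _ hab, dist_edist]
  exact ENNReal.toReal_mono (hf a b (mem_univ a) (mem_univ b))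
    (eVariationOn.edist_le _ ⟨mem_univ _, left_mem_Icc.2 hab⟩ ⟨mem_univ _, right_mem_Icc.2 hab⟩)

theorem strictMono_variationOnFromTo (hf : LocallyBoundedVariationOn f univ)
    (hinj : Function.Injective f) (a : ℝ) : StrictMono (variationOnFromTo f univ a) := by
  intro b c hbc
  have hpos : 0 < dist (f b) (f c) := dist_pos.2 (hinj.ne hbc.ne)
  rw [← sub_pos, variationOnFromTo.sub_right hf (mem_univ _) (mem_univ _) (mem_univ _)]
  exact hpos.trans_le (dist_le_variationOnFromTo hf hbc.le)

theorem surjective_variationOnFromTo (hf : LocallyBoundedVariationOn f univ) (hc : Continuous f)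
    {a : ℝ} (htop : Tendsto (fun t => dist (f a) (f t)) atTop atTop)
    (hbot : Tendsto (fun t => dist (f a) (f t)) atBot atTop) :
    Function.Surjective (variationOnFromTo f univ a) := by
  refine (continuous_variationOnFromTo hf hc a).surjective (tendsto_atTop_mono' _ ?_ htop)
    (tendsto_atBot_mono' _ ?_ (tendsto_neg_atTop_atBot.comp hbot))
  · filter_upwards [eventually_ge_atTop a] with t ht using dist_le_variationOnFromTo hf ht
  · filter_upwards [eventually_le_atBot a] with t ht
    rw [variationOnFromTo.eq_neg_swap, Function.comp_apply, dist_comm]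
    exact neg_le_neg (dist_le_variationOnFromTo hf ht)

theorem exists_orderIso_hasUnitSpeedOn (hf : LocallyBoundedVariationOn f univ) (hc : Continuous f)
    (hinj : Function.Injective f) {a : ℝ} (htop : Tendsto (fun t => dist (f a) (f t)) atTop atTop)
    (hbot : Tendsto (fun t => dist (f a) (f t)) atBot atTop) :
    ∃ e : ℝ ≃o ℝ, e 0 = a ∧ HasUnitSpeedOn (f ∘ e) univ := by
  have hsurj := surjective_variationOnFromTo hf hc htop hbot
  set V := (strictMono_variationOnFromTo hf hinj a).orderIsoOfSurjective _ hsurj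
  have hVa : V a = 0 := variationOnFromTo.self _ _ _
  have heq : naturalParameterization f univ a = f ∘ V.symm := by
    funext x
    obtain ⟨t, rfl⟩ := V.surjective x
    rw [Function.comp_apply, V.symm_apply_apply]
    exact edist_eq_zero.1 (edist_naturalParameterization_eq_zero hf (mem_univ a) (mem_univ t))
  refine ⟨V.symm, by rw [← hVa, V.symm_apply_apply], ?_⟩
  have hspeed := has_unit_speed_naturalParameterization f hf (mem_univ a)
  rwa [image_univ, hsurj.range_eq, heq] at hspeed

end UnitSpeed

/-! ### Broken lines -/

section Detour

/-- The line `ℝ w` with a tent pitched, on the left of `w`, over its part inside the set `S`. -/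
noncomputable def tent (S : Set ℂ) (w : ℂ) (t : ℝ) : ℂ :=
  t • w + max 0 (1 - gauge S (t • w)) • (Complex.I * w)

/-- The broken line that follows `ℝ w` outside the convex neighbourhood `S` of `0`, and walks around
`S` along its boundary on the left of `w`: the `tent`, projected radially from `0` to the boundary
of `S` where the line is inside `S`. -/
noncomputable def detour (S : Set ℂ) (w : ℂ) (t : ℝ) : ℂ :=
  (max 1 (gauge S (t • w)) / gauge S (tent S w t)) • tent S w t

variable {S : Set ℂ} {w : ℂ} {t : ℝ}

theorem inner_tent (S : Set ℂ) (w : ℂ) (t : ℝ) : inner ℝ w (tent S w t) = t * ‖w‖ ^ 2 := by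
  rw [tent, inner_add_right, inner_smul_right, inner_smul_right, real_inner_self_eq_norm_sq,
    inner_eq w (Complex.I * w)]
  simp only [Complex.mul_re, Complex.mul_im, Complex.I_re, Complex.I_im]
  ring

theorem cross_tent (S : Set ℂ) (w : ℂ) (t : ℝ) :
    cross w (tent S w t) = max 0 (1 - gauge S (t • w)) * ‖w‖ ^ 2 := by
  rw [tent, cross_add_right, cross_smul_right, cross_smul_right, cross_self, cross_mul_I, mul_zero,
    zero_add]

theorem tent_ne_zero (hw : w ≠ 0) : tent S w t ≠ 0 := by
  have hw' : ‖w‖ ^ 2 ≠ 0 := pow_ne_zero _ (norm_ne_zero_iff.2 hw)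
  intro h
  have ht : t = 0 := by simpa [h, hw'] using (inner_tent S w t).symm
  have hcross := cross_tent S w t
  rw [h, ht, cross_swap, cross_zero_left, zero_smul, gauge_zero, sub_zero] at hcross
  norm_num at hcross
  exact hw' hcross.symm

theorem tent_of_one_le_gauge (h : 1 ≤ gauge S (t • w)) : tent S w t = t • w := by
  rw [tent, max_eq_left (sub_nonpos.2 h), zero_smul, add_zero]

theorem detour_of_one_le_gauge (h : 1 ≤ gauge S (t • w)) : detour S w t = t • w := by
  rw [detour, tent_of_one_le_gauge h, max_eq_right h, div_self (by positivity), one_smul]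

theorem gauge_pos_of_isBounded (hS₀ : S ∈ 𝓝 0) (hS : Bornology.IsBounded S) (hw : w ≠ 0) :
    0 < gauge S w :=
  (gauge_pos (absorbent_nhds_zero hS₀) ((NormedSpace.isVonNBounded_iff ℝ).2 hS)).2 hw

theorem gauge_detour (hS₀ : S ∈ 𝓝 0) (hS : Bornology.IsBounded S) (hw : w ≠ 0) :
    gauge S (detour S w t) = max 1 (gauge S (t • w)) := by
  have hpos := gauge_pos_of_isBounded hS₀ hS (tent_ne_zero hw (S := S) (t := t))
  rw [detour, gauge_smul_of_nonneg (by positivity), smul_eq_mul, div_mul_cancel₀ _ hpos.ne']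

theorem detour_eventuallyEq_atTop (hS₀ : S ∈ 𝓝 0) (hS : Bornology.IsBounded S) (hw : w ≠ 0) :
    detour S w =ᶠ[atTop] fun t => t • w := by
  have hpos := gauge_pos_of_isBounded hS₀ hS hw
  filter_upwards [eventually_ge_atTop (gauge S w)⁻¹] with t ht
  apply detour_of_one_le_gauge
  rw [gauge_smul_of_nonneg ((inv_pos.2 hpos).le.trans ht), smul_eq_mul]
  exact (inv_le_iff_one_le_mul₀ hpos).1 ht

theorem detour_eventuallyEq_atBot (hS₀ : S ∈ 𝓝 0) (hS : Bornology.IsBounded S) (hw : w ≠ 0) :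
    detour S w =ᶠ[atBot] fun t => t • w := by
  have hpos := gauge_pos_of_isBounded hS₀ hS (neg_ne_zero.2 hw)
  filter_upwards [eventually_le_atBot (-(gauge S (-w))⁻¹)] with t ht
  apply detour_of_one_le_gauge
  rw [← neg_smul_neg, gauge_smul_of_nonneg ((inv_pos.2 hpos).le.trans (le_neg_of_le_neg ht)),
    smul_eq_mul]
  exact (inv_le_iff_one_le_mul₀ hpos).1 (le_neg_of_le_neg ht)

theorem eq_of_mul_one_sub_gauge_eq {s : ℝ} (hs : gauge S (s • w) < 1) (ht : gauge S (t • w) < 1)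
    (h : s * (1 - gauge S (t • w)) = t * (1 - gauge S (s • w))) : s = t := by
  have hsign : 0 ≤ s ↔ 0 ≤ t := by
    rw [← mul_nonneg_iff_of_pos_right (sub_pos.2 ht), h,
      mul_nonneg_iff_of_pos_right (sub_pos.2 hs)]
  obtain hs0 | hs0 := le_or_gt 0 s
  · rw [gauge_smul_of_nonneg hs0, gauge_smul_of_nonneg (hsign.1 hs0), smul_eq_mul,
      smul_eq_mul] at h
    linear_combination h
  · have ht0 : t < 0 := not_le.1 (hsign.not.1 hs0.not_ge)
    rw [← neg_smul_neg s, ← neg_smul_neg t, gauge_smul_of_nonneg (neg_pos.2 hs0).le,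
      gauge_smul_of_nonneg (neg_pos.2 ht0).le, smul_eq_mul, smul_eq_mul] at h
    linear_combination h

theorem injective_detour (hS₀ : S ∈ 𝓝 0) (hS : Bornology.IsBounded S) (hw : w ≠ 0) :
    Function.Injective (detour S w) := by
  intro s t hst
  have hgauge : max 1 (gauge S (s • w)) = max 1 (gauge S (t • w)) := by
    rw [← gauge_detour hS₀ hS hw, hst, gauge_detour hS₀ hS hw]
  have hw' : ‖w‖ ^ 2 ≠ 0 := pow_ne_zero _ (norm_ne_zero_iff.2 hw)
  have hratio : ∀ a, 0 < max 1 (gauge S (a • w)) / gauge S (tent S w a) := fun a =>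
    div_pos (by positivity) (gauge_pos_of_isBounded hS₀ hS (tent_ne_zero hw))
  have hinner := congrArg (inner ℝ w) hst
  have hcross := congrArg (cross w) hst
  simp only [detour, inner_smul_right, cross_smul_right, inner_tent, cross_tent, ← mul_assoc,
    mul_left_inj' hw'] at hinner hcross
  have hprod : s * max 0 (1 - gauge S (t • w)) = t * max 0 (1 - gauge S (s • w)) := by
    refine mul_left_cancel₀ (mul_pos (hratio s) (hratio t)).ne' ?_
    linear_combination (max 1 (gauge S (t • w)) / gauge S (tent S w t)) *
      max 0 (1 - gauge S (t • w)) * hinner -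
      (max 1 (gauge S (t • w)) / gauge S (tent S w t)) * t * hcross
  obtain hs | hs := lt_or_ge (gauge S (s • w)) 1 <;> obtain ht | ht := lt_or_ge (gauge S (t • w)) 1
  · rw [max_eq_right (sub_pos.2 hs).le, max_eq_right (sub_pos.2 ht).le] at hprod
    exact eq_of_mul_one_sub_gauge_eq hs ht hprod
  · rw [max_eq_left (sub_nonpos.2 ht), max_eq_right (sub_pos.2 hs).le, mul_zero,
      zero_eq_mul, or_iff_left (sub_pos.2 hs).ne'] at hprod
    norm_num [hprod] at ht
  · rw [max_eq_left (sub_nonpos.2 hs), max_eq_right (sub_pos.2 ht).le, mul_zero,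
      mul_eq_zero, or_iff_left (sub_pos.2 ht).ne'] at hprod
    norm_num [hprod] at hs
  · rw [detour_of_one_le_gauge hs, detour_of_one_le_gauge ht] at hst
    exact smul_left_injective ℝ hw hst

theorem locallyLipschitz_smul {r : ℝ → ℝ} {v : ℝ → ℂ} (hr : LocallyLipschitz r)
    (hv : LocallyLipschitz v) : LocallyLipschitz fun t => r t • v t :=
  (show ContDiff ℝ 1 fun z : ℝ × ℂ => z.1 • z.2 by fun_prop).locallyLipschitz.comp (hr.prodMk hv)

theorem locallyLipschitz_inv {r : ℝ → ℝ} (hr : LocallyLipschitz r) (h0 : ∀ t, r t ≠ 0) :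
    LocallyLipschitz fun t => (r t)⁻¹ := by
  intro x
  obtain ⟨C, s, hs, hC⟩ := (contDiffAt_inv ℝ (n := 1) (h0 x)).exists_lipschitzOnWith
  obtain ⟨D, t, ht, hD⟩ := hr x
  exact ⟨C * D, t ∩ r ⁻¹' s, inter_mem ht (hr.continuous.continuousAt hs),
    hC.comp (hD.mono inter_subset_left) fun y hy => hy.2⟩

theorem locallyLipschitz_detour (hSc : Convex ℝ S) (hS₀ : S ∈ 𝓝 0) (hS : Bornology.IsBounded S)
    (hw : w ≠ 0) : LocallyLipschitz (detour S w) := by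
  obtain ⟨C, hC⟩ := hSc.lipschitz_gauge hS₀
  have hline : LocallyLipschitz fun t : ℝ => t • w :=
    locallyLipschitz_smul LocallyLipschitz.id (LocallyLipschitz.const w)
  have hgauge : LocallyLipschitz fun t : ℝ => gauge S (t • w) := hC.locallyLipschitz.comp hline
  have htent : LocallyLipschitz (tent S w) := hline.add (locallyLipschitz_smul
    (((LocallyLipschitz.const 1).sub hgauge).const_max 0) (LocallyLipschitz.const _))
  have hinv : LocallyLipschitz fun t => (gauge S (tent S w t))⁻¹ :=
    locallyLipschitz_inv (hC.locallyLipschitz.comp htent) fun t =>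
      (gauge_pos_of_isBounded hS₀ hS (tent_ne_zero hw)).ne'
  simpa only [smul_smul, div_eq_mul_inv] using!
    locallyLipschitz_smul (hgauge.const_max 1) (locallyLipschitz_smul hinv htent)

end Detour

section BrokenLine

variable {w : ℂ}

theorem isometry_add_smul (p : ℂ) (hw : ‖w‖ = 1) : Isometry fun t : ℝ => p + t • w :=
  Isometry.of_dist_eq fun x y => by
    rw [dist_add_left, dist_eq_norm, ← sub_smul, norm_smul, hw, mul_one, Real.dist_eq,
      Real.norm_eq_abs]

theorem tendsto_inner_add_smul_atTop (p : ℂ) (hw : w ≠ 0) :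
    Tendsto (fun t : ℝ => inner ℝ w (p + t • w)) atTop atTop := by
  simp only [inner_add_right, inner_smul_right]
  exact tendsto_atTop_add_const_left _ _ (tendsto_id.atTop_mul_const (real_inner_self_pos.2 hw))

theorem tendsto_inner_add_smul_atBot (p : ℂ) (hw : w ≠ 0) :
    Tendsto (fun t : ℝ => inner ℝ w (p + t • w)) atBot atBot := by
  simp only [inner_add_right, inner_smul_right]
  exact tendsto_atBot_add_const_left _ _ (tendsto_id.atBot_mul_const (real_inner_self_pos.2 hw))

theorem tendsto_dist_atTop_of_tendsto_inner {l : Filter ℝ} {f : ℝ → ℂ} (q : ℂ)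
    (h : Tendsto (fun t => inner ℝ w (f t)) l (Bornology.cobounded ℝ)) :
    Tendsto (fun t => dist q (f t)) l atTop :=
  (Metric.tendsto_dist_left_cobounded_atTop q).comp
    ((tendsto_comap_iff.2 h).mono_right (innerSL ℝ w).lipschitz.comap_cobounded_le)

end BrokenLine

namespace ConvexPolygon

variable {K : ConvexPolygon} {p c w : ℂ}

theorem isBrokenLine_line (hw : ‖w‖ = 1) (h : ∀ t : ℝ, p + t • w ∉ K.obstacle) :
    K.IsBrokenLine p w fun t => p + t • w where
  start := by rw [zero_smul, add_zero]
  straight _ _ := rfl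
  mem_free := h
  mem_line_or_frontier t := Or.inl ⟨t, rfl⟩
  unitSpeed := hasUnitSpeedOn_of_isometry (isometry_add_smul p hw) univ
  injective := (isometry_add_smul p hw).injective
  atTop := tendsto_inner_add_smul_atTop p (norm_ne_zero_iff.1 (hw ▸ one_ne_zero))
  atBot := tendsto_inner_add_smul_atBot p (norm_ne_zero_iff.1 (hw ▸ one_ne_zero))

theorem preimage_add_obstacle_mem_nhds (hc : c ∈ K.obstacle) :
    (c + ·) ⁻¹' K.obstacle ∈ 𝓝 (0 : ℂ) :=
  (K.isOpen_obstacle.preimage (continuous_const_add c)).mem_nhds (by simpa using hc)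

theorem isBounded_preimage_add_obstacle (c : ℂ) :
    Bornology.IsBounded ((c + ·) ⁻¹' K.obstacle) :=
  (K.isBounded_obstacle.vadd (-c)).subset fun x hx => ⟨c + x, hx, by simp⟩

theorem add_mem_free_iff {x : ℂ} (hc : c ∈ K.obstacle) :
    c + x ∈ K.free ↔ 1 ≤ gauge ((c + ·) ⁻¹' K.obstacle) x := by
  rw [← not_lt, gauge_lt_one_iff_mem_interior (K.convex_obstacle.translate_preimage_right c)
    (preimage_add_obstacle_mem_nhds hc),
    (K.isOpen_obstacle.preimage (continuous_const_add c)).interior_eq]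
  rfl

theorem add_mem_frontier_obstacle {x : ℂ} (hc : c ∈ K.obstacle)
    (hx : gauge ((c + ·) ⁻¹' K.obstacle) x = 1) : c + x ∈ frontier K.obstacle := by
  have hfr := (gauge_eq_one_iff_mem_frontier (K.convex_obstacle.translate_preimage_right c)
    (preimage_add_obstacle_mem_nhds hc)).1 hx
  rwa [show (c + ·) ⁻¹' K.obstacle = Homeomorph.addLeft c ⁻¹' K.obstacle from rfl,
    ← Homeomorph.preimage_frontier] at hfr

theorem add_detour_mem_free (hc : c ∈ K.obstacle) (hw : w ≠ 0) (t : ℝ) :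
    c + detour ((c + ·) ⁻¹' K.obstacle) w t ∈ K.free := by
  rw [add_mem_free_iff hc, gauge_detour (preimage_add_obstacle_mem_nhds hc)
    (isBounded_preimage_add_obstacle c) hw]
  exact le_max_left _ _

theorem add_detour_eq_or_mem_frontier (hc : c ∈ K.obstacle) (hw : w ≠ 0) (t : ℝ) :
    c + detour ((c + ·) ⁻¹' K.obstacle) w t = c + t • w ∨
      c + detour ((c + ·) ⁻¹' K.obstacle) w t ∈ frontier K.obstacle := by
  obtain h | h := le_total 1 (gauge ((c + ·) ⁻¹' K.obstacle) (t • w))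
  · exact Or.inl (by rw [detour_of_one_le_gauge h])
  · refine Or.inr (add_mem_frontier_obstacle hc ?_)
    rw [gauge_detour (preimage_add_obstacle_mem_nhds hc) (isBounded_preimage_add_obstacle c) hw,
      max_eq_left h]

theorem exists_isBrokenLine_of_mem_obstacle (hp : p ∈ K.free) (hw : w ≠ 0) {r : ℝ}
    (hr : p + r • w ∈ K.obstacle) : ∃ β, K.IsBrokenLine p w β := by
  obtain ⟨c, rfl⟩ : ∃ c, p = c + (-r) • w := ⟨p + r • w, by module⟩
  have hc : c ∈ K.obstacle := by simpa using hr
  have hS₀ := preimage_add_obstacle_mem_nhds hc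
  have hS := isBounded_preimage_add_obstacle (K := K) c
  set f : ℝ → ℂ := fun t => c + detour ((c + ·) ⁻¹' K.obstacle) w t with hf
  have hinj : Function.Injective f := (add_right_injective c).comp (injective_detour hS₀ hS hw)
  have hlip : LocallyLipschitz f := (LocallyLipschitz.const c).add
    (locallyLipschitz_detour (K.convex_obstacle.translate_preimage_right c) hS₀ hS hw)
  have htop : Tendsto (fun t => inner ℝ w (f t)) atTop atTop :=
    (tendsto_inner_add_smul_atTop c hw).congr' ((detour_eventuallyEq_atTop hS₀ hS hw).mono
      fun t ht => by simp only [hf, ht])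
  have hbot : Tendsto (fun t => inner ℝ w (f t)) atBot atBot :=
    (tendsto_inner_add_smul_atBot c hw).congr' ((detour_eventuallyEq_atBot hS₀ hS hw).mono
      fun t ht => by simp only [hf, ht])
  obtain ⟨e, he, hspeed⟩ := exists_orderIso_hasUnitSpeedOn
    (locallyBoundedVariationOn_of_locallyLipschitz hlip univ) hlip.continuous hinj (a := -r)
    (tendsto_dist_atTop_of_tendsto_inner _ (htop.mono_right IsOrderBornology.atTop_le_cobounded))
    (tendsto_dist_atTop_of_tendsto_inner _ (hbot.mono_right IsOrderBornology.atBot_le_cobounded))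
  refine ⟨f ∘ e, ?_, fun h => absurd hr (h r), fun t => add_detour_mem_free hc hw _, fun t => ?_,
    hspeed, hinj.comp e.injective, htop.comp e.tendsto_atTop, hbot.comp e.tendsto_atBot⟩
  · rw [Function.comp_apply, he, hf]
    exact congrArg (c + ·) (detour_of_one_le_gauge ((add_mem_free_iff hc).1 hp))
  · refine (add_detour_eq_or_mem_frontier hc hw (e t)).imp_left fun h => ⟨e t + r, ?_⟩
    refine h.trans ?_
    module

theorem exists_isBrokenLine (hp : p ∈ K.free) (hw : ‖w‖ = 1) : ∃ β, K.IsBrokenLine p w β := by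
  by_cases h : ∃ r : ℝ, p + r • w ∈ K.obstacle
  · exact exists_isBrokenLine_of_mem_obstacle hp (norm_ne_zero_iff.1 (hw ▸ one_ne_zero))
      h.choose_spec
  · exact ⟨_, isBrokenLine_line hw (not_exists.1 h)⟩

end ConvexPolygon

/-! ### Walks and searches -/

section Walk

theorem walk_zero (p q : ℂ) : p + ((0 : ℝ) / ‖q - p‖) • (q - p) = p := by
  rw [zero_div, zero_smul, add_zero]

theorem walk_norm (p q : ℂ) : p + (‖q - p‖ / ‖q - p‖) • (q - p) = q := by
  obtain rfl | h := eq_or_ne q p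
  · rw [sub_self, smul_zero, add_zero]
  · rw [div_self (norm_ne_zero_iff.2 (sub_ne_zero.2 h)), one_smul, add_sub_cancel]

theorem lipschitzWith_walk (p q : ℂ) :
    LipschitzWith 1 fun t : ℝ => p + (t / ‖q - p‖) • (q - p) := by
  refine LipschitzWith.of_dist_le_mul fun a b => ?_
  rw [NNReal.coe_one, one_mul, dist_add_left, dist_eq_norm, ← sub_smul, norm_smul, Real.dist_eq,
    ← sub_div, norm_div, norm_norm, Real.norm_eq_abs]
  obtain h | h := eq_or_ne ‖q - p‖ 0
  · rw [h, mul_zero]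
    exact abs_nonneg _
  · exact (div_mul_cancel₀ _ h).le

theorem walk_image_subset_segment (p q : ℂ) :
    (fun t : ℝ => p + (t / ‖q - p‖) • (q - p)) '' Icc 0 ‖q - p‖ ⊆ segment ℝ p q := by
  rw [segment_eq_image']
  rintro _ ⟨t, ht, rfl⟩
  exact mem_image_of_mem _
    ⟨div_nonneg ht.1 (norm_nonneg _), div_le_one_of_le₀ ht.2 (norm_nonneg _)⟩

end Walk

namespace State

variable {X : State} {g : ℝ → ℂ} {q : ℂ} {τ : ℝ} {ph : Phase}

theorem move_path_of_le {t : ℝ} (h : t ≤ X.time) : (X.move g τ ph).path t = X.path t := if_pos h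

theorem move_path_of_ge (hg : g 0 = X.pos) {t : ℝ} (h : X.time ≤ t) :
    (X.move g τ ph).path t = g (t - X.time) := by
  obtain rfl | h := h.eq_or_lt
  · rw [move_path_of_le le_rfl, sub_self, hg, pos]
  · exact if_neg h.not_ge

theorem move_pos (hg : g 0 = X.pos) (hτ : 0 ≤ τ) : (X.move g τ ph).pos = g τ :=
  (move_path_of_ge hg (le_add_of_nonneg_right hτ)).trans
    (congrArg g (add_sub_cancel_left X.time τ))

theorem walkTo_pos : (X.walkTo q ph).pos = q :=
  (move_pos (walk_zero _ _) (norm_nonneg _)).trans (walk_norm _ _)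

theorem visited_move (hg : g 0 = X.pos) (h0 : 0 ≤ X.time) (hτ : 0 ≤ τ) :
    (X.move g τ ph).visited = X.visited ∪ g '' Icc 0 τ := by
  have hle : X.time ≤ X.time + τ := le_add_of_nonneg_right hτ
  have hIcc : Icc X.time (X.time + τ) = (X.time + ·) '' Icc 0 τ := by
    rw [image_const_add_Icc, add_zero]
  change (X.move g τ ph).path '' Icc 0 (X.time + τ) = _
  rw [← Icc_union_Icc_eq_Icc h0 hle, image_union]
  refine congrArg₂ (· ∪ ·) (image_congr fun t ht => move_path_of_le ht.2) ?_
  rw [hIcc, image_image]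
  refine image_congr fun t ht => ?_
  rw [move_path_of_ge hg (le_add_of_nonneg_right ht.1), add_sub_cancel_left]

theorem visited_subset_walkTo (h0 : 0 ≤ X.time) : X.visited ⊆ (X.walkTo q ph).visited := by
  rw [walkTo, visited_move (walk_zero _ _) h0 (norm_nonneg _)]
  exact subset_union_left

theorem visited_walkTo_of_segment_subset (h0 : 0 ≤ X.time) (h : segment ℝ X.pos q ⊆ X.visited) :
    (X.walkTo q ph).visited = X.visited := by
  rw [walkTo, visited_move (walk_zero _ _) h0 (norm_nonneg _)]
  exact union_eq_self_of_subset_right ((walk_image_subset_segment _ _).trans h)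

theorem lipschitzOnWith_move (h0 : 0 ≤ X.time) (hX : LipschitzOnWith 1 X.path (Icc 0 X.time))
    (hg : g 0 = X.pos) (hgl : LipschitzOnWith 1 g (Ici 0)) :
    LipschitzOnWith 1 (X.move g τ ph).path (Ici 0) := by
  refine lipschitzOnWith_of_inter_Iic_of_inter_Ici h0 ?_ ?_
  · rintro a ⟨ha, haX⟩ b ⟨hb, hbX⟩
    rw [move_path_of_le haX, move_path_of_le hbX]
    exact hX ⟨ha, haX⟩ ⟨hb, hbX⟩
  · rintro a ⟨-, haX⟩ b ⟨-, hbX⟩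
    rw [move_path_of_ge hg haX, move_path_of_ge hg hbX, ← edist_sub_right a b X.time]
    exact hgl (mem_Ici.2 (sub_nonneg.2 haX)) (mem_Ici.2 (sub_nonneg.2 hbX))

end State

namespace ConvexPolygon

variable {K : ConvexPolygon} {X : State} {s p q w : ℂ} {g : ℝ → ℂ} {θ τ Q : ℝ} {ph : Phase}

section Feasible

/-- What holds for the path of every execution from `s`, whatever the robot sees: it starts in `s`,
has speed at most `1`, and avoids the obstacle. -/
structure IsFeasible (K : ConvexPolygon) (s : ℂ) (X : State) : Prop where
  time_nonneg : 0 ≤ X.time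
  path_zero : X.path 0 = s
  lipschitz : LipschitzOnWith 1 X.path (Icc 0 X.time)
  visited_subset : X.visited ⊆ K.free

namespace IsFeasible

theorem isCompact_visited (h : K.IsFeasible s X) : IsCompact X.visited :=
  isCompact_Icc.image_of_continuousOn h.lipschitz.continuousOn

theorem isPreconnected_visited (h : K.IsFeasible s X) : IsPreconnected X.visited :=
  isPreconnected_Icc.image _ h.lipschitz.continuousOn

theorem pos_mem_visited (h : K.IsFeasible s X) : X.pos ∈ X.visited :=
  mem_image_of_mem _ ⟨h.time_nonneg, le_rfl⟩

theorem visited_eq_singleton (h : K.IsFeasible s X) (h0 : X.time = 0) : X.visited = {s} := by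
  rw [State.visited, h0, Icc_self, image_singleton, h.path_zero]

theorem pos_eq (h : K.IsFeasible s X) (h0 : X.time = 0) : X.pos = s := by
  rw [State.pos, h0, h.path_zero]

theorem move (h : K.IsFeasible s X) (hg : g 0 = X.pos) (hgl : LipschitzOnWith 1 g (Ici 0))
    (hτ : 0 ≤ τ) (hF : g '' Icc 0 τ ⊆ K.free) : K.IsFeasible s (X.move g τ ph) where
  time_nonneg := add_nonneg h.time_nonneg hτ
  path_zero := (State.move_path_of_le h.time_nonneg).trans h.path_zero
  lipschitz :=
    (State.lipschitzOnWith_move h.time_nonneg h.lipschitz hg hgl).mono Icc_subset_Ici_self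
  visited_subset := by
    rw [State.visited_move hg h.time_nonneg hτ]
    exact union_subset h.visited_subset hF

theorem walkTo (h : K.IsFeasible s X) (hq : K.Visible X.pos q) :
    K.IsFeasible s (X.walkTo q ph) :=
  h.move (walk_zero _ _) (lipschitzWith_walk _ _).lipschitzOnWith (norm_nonneg _)
    ((walk_image_subset_segment _ _).trans (visible_iff_segment_subset_free.1 hq))

theorem mem_visited_walkTo (h : K.IsFeasible s X) (hq : K.Visible X.pos q) :
    q ∈ (X.walkTo q ph).visited := by
  simpa only [State.walkTo_pos] using (h.walkTo hq (ph := ph)).pos_mem_visited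

theorem route_zero (h : K.IsFeasible s X) : X.route 0 = s := by
  rw [State.route, zero_mul, h.path_zero]

theorem image_route (h : K.IsFeasible s X) : X.route '' Icc 0 1 = X.visited := by
  have hscale : (· * X.time) '' Icc 0 1 = Icc 0 X.time := by
    rw [image_mul_right_Icc zero_le_one h.time_nonneg, zero_mul, one_mul]
  rw [State.visited, ← hscale, image_image]
  rfl

theorem lipschitzOnWith_route (h : K.IsFeasible s X) :
    LipschitzOnWith X.time.toNNReal X.route (Icc 0 1) := by
  have hscale : LipschitzWith X.time.toNNReal fun u : ℝ => u * X.time :=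
    LipschitzWith.of_dist_le_mul fun a b => by
      rw [Real.coe_toNNReal _ h.time_nonneg, Real.dist_eq, Real.dist_eq, ← sub_mul, abs_mul,
        abs_of_nonneg h.time_nonneg, mul_comm]
  simpa only [one_mul] using! h.lipschitz.comp hscale.lipschitzOnWith fun u hu =>
    ⟨mul_nonneg hu.1 h.time_nonneg, mul_le_of_le_one_left h.time_nonneg hu.2⟩

theorem eVariationOn_route_lt_top (h : K.IsFeasible s X) :
    eVariationOn X.route (Icc 0 1) < ⊤ := by
  simpa only [inter_self] using (h.lipschitzOnWith_route.locallyBoundedVariationOn 0 1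
    (left_mem_Icc.2 zero_le_one) (right_mem_Icc.2 zero_le_one)).lt_top

theorem isPath_route (h : K.IsFeasible s X) : K.IsPath X.route :=
  ⟨h.lipschitzOnWith_route.continuousOn,
    mapsTo_iff_image_subset.2 (h.image_route.trans_subset h.visited_subset)⟩

theorem isWatchmanRoute_route (h : K.IsFeasible s X) (hfin : K.Finished X.visited) :
    K.IsWatchmanRoute X.route :=
  ⟨h.isPath_route, by rw [h.image_route, K.visibleSet_of_finished hfin]⟩

end IsFeasible

end Feasible

section Search

/-- The motion `g` from `p` is a search in the direction `±w`: it has speed at most `1`, stays in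
the free space, and reaches points of the line `p + ℝ w` arbitrarily far away on both sides. -/
structure IsSearch (K : ConvexPolygon) (p w : ℂ) (g : ℝ → ℂ) : Prop where
  direction_ne_zero : w ≠ 0
  zero : g 0 = p
  lipschitz : LipschitzOnWith 1 g (Ici 0)
  mem_free : ∀ t, g t ∈ K.free
  far : ∀ T : ℝ, ∃ t ≥ 0, ∃ r ≥ T, g t = p + r • w
  far_neg : ∀ T : ℝ, ∃ t ≥ 0, ∃ r ≥ T, g t = p - r • w

namespace IsBrokenLine

variable {β : ℝ → ℂ}

theorem exists_forall_eq_add_smul (hβ : K.IsBrokenLine p w β) :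
    ∃ M, ∀ t, M < |inner ℝ w (β t)| → ∃ r : ℝ, β t = p + r • w := by
  obtain ⟨M, hM⟩ := (K.isBounded_obstacle.closure.subset frontier_subset_closure
    |>.isCompact_closure.bddAbove_image (f := fun z : ℂ => |inner ℝ w z|)
    (by fun_prop)).mono (image_mono subset_closure)
  refine ⟨M, fun t ht => (hβ.mem_line_or_frontier t).resolve_right fun h => ?_⟩
  exact ht.not_ge (hM (mem_image_of_mem _ h))

theorem exists_ge_eq_add_smul (hβ : K.IsBrokenLine p w β) (hw : w ≠ 0) (T : ℝ) :
    ∃ x, ∃ r ≥ T, β x = p + r • w := by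
  obtain ⟨M, hM⟩ := hβ.exists_forall_eq_add_smul
  obtain ⟨x, hxM, hxT⟩ := ((hβ.atTop.eventually_gt_atTop M).and
    (hβ.atTop.eventually_ge_atTop (inner ℝ w (p + T • w)))).exists
  obtain ⟨r, hr⟩ := hM x (hxM.trans_le (le_abs_self _))
  rw [hr, inner_add_right, inner_add_right, inner_smul_right, inner_smul_right] at hxT
  exact ⟨x, r, le_of_mul_le_mul_right (le_of_add_le_add_left hxT) (real_inner_self_pos.2 hw), hr⟩

theorem exists_ge_eq_sub_smul (hβ : K.IsBrokenLine p w β) (hw : w ≠ 0) (T : ℝ) :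
    ∃ x, ∃ r ≥ T, β x = p - r • w := by
  obtain ⟨M, hM⟩ := hβ.exists_forall_eq_add_smul
  obtain ⟨x, hxM, hxT⟩ := ((hβ.atBot.eventually_lt_atBot (-M)).and
    (hβ.atBot.eventually_le_atBot (inner ℝ w (p + (-T) • w)))).exists
  obtain ⟨r, hr⟩ := hM x ((lt_neg_of_lt_neg hxM).trans_le (neg_le_abs _))
  rw [hr, inner_add_right, inner_add_right, inner_smul_right, inner_smul_right] at hxT
  exact ⟨x, -r, le_neg_of_le_neg (le_of_mul_le_mul_right (le_of_add_le_add_left hxT)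
    (real_inner_self_pos.2 hw)), by rw [hr, neg_smul, sub_neg_eq_add]⟩

theorem isSearch_zigzag (hβ : K.IsBrokenLine p w β) (hw : w ≠ 0) (hQ : 0 < Q) :
    K.IsSearch p w fun t => β (zigzag Q t) where
  direction_ne_zero := hw
  zero := by rw [zigzag_zero, hβ.start]
  lipschitz := by
    simpa only [one_mul, Function.comp_def] using
      (lipschitzOnWith_of_hasUnitSpeedOn hβ.unitSpeed).comp (lipschitzOnWith_zigzag hQ)
        (mapsTo_univ _ _)
  mem_free _ := hβ.mem_free _
  far T := by
    obtain ⟨x, r, hr, hx⟩ := hβ.exists_ge_eq_add_smul hw T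
    obtain ⟨t, ht, rfl⟩ := exists_zigzag_eq hQ x
    exact ⟨t, ht, r, hr, hx⟩
  far_neg T := by
    obtain ⟨x, r, hr, hx⟩ := hβ.exists_ge_eq_sub_smul hw T
    obtain ⟨t, ht, rfl⟩ := exists_zigzag_eq hQ x
    exact ⟨t, ht, r, hr, hx⟩

end IsBrokenLine

namespace IsSearch

theorem isFeasible_move (h : K.IsSearch X.pos w g) (hX : K.IsFeasible s X) (hτ : 0 ≤ τ) :
    K.IsFeasible s (X.move g τ ph) :=
  hX.move h.zero h.lipschitz hτ (image_subset_iff.2 fun t _ => h.mem_free t)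

theorem lipschitzOnWith_move (h : K.IsSearch X.pos w g) (hX : K.IsFeasible s X) :
    LipschitzOnWith 1 (X.move g τ ph).path (Ici 0) :=
  State.lipschitzOnWith_move hX.time_nonneg hX.lipschitz h.zero h.lipschitz

theorem exists_firstTime (h : K.IsSearch X.pos w g) (hX : K.IsFeasible s X)
    (hθ : θ ∈ Icc (-(Real.pi / 2)) (Real.pi / 2)) : ∃ τ, FirstTime (K.StopAt θ) X g τ := by
  obtain ⟨T, hT⟩ := (eventually_stopAt (K := K) X.pos h.direction_ne_zero).exists
  obtain ⟨t, ht, r, hr, hgt⟩ := h.far T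
  obtain ⟨t', ht', r', hr', hgt'⟩ := h.far_neg T
  have h0 : 0 ≤ max t t' := ht.trans (le_max_left t t')
  have hM := h.isFeasible_move hX h0 (ph := X.phase)
  have hmem : g '' Icc 0 (max t t') ⊆ (X.move g (max t t') X.phase).visited := by
    rw [State.visited_move h.zero hX.time_nonneg h0]
    exact subset_union_right
  refine exists_isLeast_stopAt (h.lipschitzOnWith_move hX (τ := 0) (ph := X.phase)).continuousOn
    hθ.2 ⟨_, h0, StopAt.mono hθ.1 (hT _ hM.isCompact_visited hM.isPreconnected_visited
      hM.visited_subset ⟨r, hr, ?_⟩ ⟨r', hr', ?_⟩)⟩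
  · exact hmem ⟨t, ⟨ht, le_max_left t t'⟩, hgt⟩
  · exact hmem ⟨t', ⟨ht', le_max_right t t'⟩, hgt'⟩

theorem pos_of_firstTime (h : K.IsSearch X.pos w g) (hX : K.IsFeasible s X)
    (hno : ¬ K.StopAt θ X.visited) (hτ : FirstTime (K.StopAt θ) X g τ) : 0 < τ := by
  refine hτ.1.1.lt_of_ne ?_
  rintro rfl
  apply hno
  simpa only [State.visited_move h.zero hX.time_nonneg le_rfl, Icc_self, image_singleton, h.zero,
    union_singleton, insert_eq_of_mem hX.pos_mem_visited] using hτ.1.2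

theorem finished_or_not_inEdgeInterior (h : K.IsSearch X.pos w g) (hX : K.IsFeasible s X)
    (hno : ¬ K.StopAt θ X.visited) (hτ : FirstTime (K.StopAt θ) X g τ) :
    K.Finished (X.move g τ ph).visited ∨ ¬ K.InEdgeInterior (X.move g τ ph).pos :=
  or_iff_not_imp_left.2 fun hfin => not_inEdgeInterior_of_isLeast (f := (X.move g τ ph).path)
    ((h.lipschitzOnWith_move hX).continuousOn.mono Icc_subset_Ici_self) hX.time_nonneg hτ
    (h.pos_of_firstTime hX hno hτ)
    (mapsTo_iff_image_subset.2 (h.isFeasible_move hX hτ.1.1 (ph := ph)).visited_subset) hfin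

end IsSearch

theorem segment_subset_image_zigzag (p w : ℂ) (hQ : 0 < Q) (hτ : 0 ≤ τ) :
    segment ℝ (p + zigzag Q τ • w) p ⊆ (fun t => p + zigzag Q t • w) '' Icc 0 τ := by
  have himage : (fun t => p + zigzag Q t • w) '' Icc 0 τ =
      AffineMap.lineMap p (p + w) '' (zigzag Q '' Icc 0 τ) := by
    rw [image_image]
    exact image_congr fun t _ => by
      rw [AffineMap.lineMap_apply, vsub_eq_sub, add_sub_cancel_left, vadd_eq_add, add_comm]
  have hconn : IsPreconnected (zigzag Q '' Icc 0 τ) := isPreconnected_Icc.image _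
    ((lipschitzOnWith_zigzag hQ).continuousOn.mono Icc_subset_Ici_self)
  rw [himage]
  refine ((hconn.ordConnected.convex).affine_image _).segment_subset ?_ ?_
  · exact ⟨_, mem_image_of_mem _ ⟨hτ, le_rfl⟩, by simp [AffineMap.lineMap_apply, add_comm]⟩
  · exact ⟨_, mem_image_of_mem _ ⟨le_rfl, hτ⟩, by simp [AffineMap.lineMap_apply, add_comm]⟩

end Search

end ConvexPolygon

/-! ### Invariant, termination and progress -/

namespace ConvexPolygon

variable {K : ConvexPolygon} {X Y : State} {s w : ℂ} {Q τ : ℝ} {ph : Phase} {β : ℝ → ℂ}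
  {σ : K.Scope}

section Invariant

theorem IsFeasible.with_phase (h : K.IsFeasible s X) : K.IsFeasible s { X with phase := ph } :=
  ⟨h.time_nonneg, h.path_zero, h.lipschitz, h.visited_subset⟩

theorem segment_pos_subset_visited_zigzag (h0 : 0 ≤ X.time) (hQ : 0 < Q) (hτ : 0 ≤ τ) :
    segment ℝ (X.move (fun t => X.pos + zigzag Q t • w) τ ph).pos X.pos ⊆
      (X.move (fun t => X.pos + zigzag Q t • w) τ ph).visited := by
  have hzero : X.pos + zigzag Q 0 • w = X.pos := by rw [zigzag_zero, zero_smul, add_zero]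
  rw [State.move_pos hzero hτ, State.visited_move hzero h0 hτ]
  exact (segment_subset_image_zigzag _ _ hQ hτ).trans subset_union_right

theorem IsScope.isBrokenLine_parallel {P : Set ℂ} (hσ : K.IsScope P σ) (h : σ.pR = σ.pL)
    (hw : ‖w‖ = 1) (hpar : cross w (σ.vL - σ.vR) = 0) :
    K.IsBrokenLine σ.pR w fun t => σ.pR + t • w := by
  obtain ⟨c, hc⟩ := exists_eq_smul_of_cross_eq_zero hσ.vL_sub_vR_ne_zero
    (by rw [cross_swap, hpar, neg_zero])
  refine isBrokenLine_line hw fun t => ?_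
  rw [hc, smul_smul]
  exact hσ.add_smul_mem_free_of_pR_eq_pL h (t * c)

/-- What is known, besides feasibility, about the state `X` of an execution from `s` when it is in
the given phase. -/
def PhaseInvariant (K : ConvexPolygon) (s : ℂ) (X : State) : Phase → Prop
  | .opening => X.pos = s ∧
      ∃ σ, K.IsScope X.visited σ ∧ 0 ≤ σ.angle ∧ (X.time = 0 ∨ σ.angle ≤ Real.pi / 2)
  | .parallel w Q => X.time = 0 ∧ 0 < Q ∧
      K.IsSearch X.pos w (fun t => X.pos + zigzag Q t • w) ∧ ¬ K.StopAt (Real.pi / 2) X.visited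
  | .bisection β Q => (∃ w, K.IsSearch X.pos w fun t => β (zigzag Q t)) ∧
      ¬ K.StopAt (-(Real.pi / 8)) X.visited
  | .closing => K.Finished X.visited ∨ ¬ K.InEdgeInterior X.pos

/-- What is known about every state reached by an execution from `s`. -/
structure Invariant (K : ConvexPolygon) (s : ℂ) (X : State) : Prop extends K.IsFeasible s X where
  phaseInvariant : K.PhaseInvariant s X X.phase

theorem invariant_init (hs : s ∈ K.free) : K.Invariant s (State.init s) := by
  have hfeas : K.IsFeasible s (State.init s) :=
    ⟨le_rfl, rfl, (LipschitzWith.const s).lipschitzOnWith.weaken zero_le_one, by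
      rintro _ ⟨_, _, rfl⟩
      exact hs⟩
  have hvisited := hfeas.visited_eq_singleton rfl
  have hfin : ¬ K.Finished (State.init s).visited := fun h => by
    obtain ⟨i, hi⟩ := K.exists_side_pos s
    obtain ⟨x, hx, hxi⟩ := K.edgeSeen_iff.1 (h i)
    rw [hvisited, mem_singleton_iff] at hx
    exact hi.not_ge (hx ▸ hxi)
  obtain ⟨σ, hσ⟩ := K.exists_isScope hfeas.isCompact_visited ⟨_, hfeas.pos_mem_visited⟩
    hfeas.visited_subset hfin
  have hp : σ.pR = σ.pL :=
    (hvisited ▸ subsingleton_singleton : (State.init s).visited.Subsingleton) hσ.memR hσ.memL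
  exact ⟨hfeas, rfl, σ, hσ, hσ.angle_nonneg_of_pR_eq_pL hp, Or.inl rfl⟩

namespace Invariant

theorem time_eq_zero (h : K.Invariant s X) (hphase : X.phase = .opening)
    (hσ : K.IsScope X.visited σ) (hangle : Real.pi / 2 < σ.angle) : X.time = 0 := by
  obtain ⟨-, σ', hσ', -, h0⟩ : K.PhaseInvariant s X .opening := hphase ▸ h.phaseInvariant
  refine h0.resolve_right fun hle => hangle.not_ge ?_
  rwa [hσ.angle_eq h.isPreconnected_visited h.visited_subset hσ']

theorem chooseParallel (h : K.Invariant s X) (hphase : X.phase = .opening)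
    (hσ : K.IsScope X.visited σ) (hangle : Real.pi / 2 < σ.angle) (hw : ‖w‖ = 1)
    (hpar : cross w (σ.vL - σ.vR) = 0) :
    K.Invariant s { X with phase := .parallel w |inner ℝ w (σ.vL - σ.vR)| } := by
  have h0 := h.time_eq_zero hphase hσ hangle
  have hw0 : w ≠ 0 := norm_ne_zero_iff.1 (hw ▸ one_ne_zero)
  have hQ : 0 < |inner ℝ w (σ.vL - σ.vR)| :=
    abs_pos.2 (inner_ne_zero_of_cross_eq_zero hw0 hσ.vL_sub_vR_ne_zero hpar)
  have hpos : ∀ x ∈ X.visited, x = X.pos := fun x hx =>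
    (h.visited_eq_singleton h0 ▸ subsingleton_singleton : X.visited.Subsingleton) hx
      h.pos_mem_visited
  have hline := hσ.isBrokenLine_parallel ((hpos _ hσ.memR).trans (hpos _ hσ.memL).symm) hw hpar
  rw [hpos _ hσ.memR] at hline
  exact ⟨h.with_phase, h0, hQ, hline.isSearch_zigzag hw0 hQ,
    not_stopAt_of_lt h.isPreconnected_visited h.visited_subset hσ hangle⟩

theorem parallelReturn (h : K.Invariant s X) (hphase : X.phase = .parallel w Q)
    (hτ : FirstTime (K.StopAt (Real.pi / 2)) X (fun t => X.pos + zigzag Q t • w) τ)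
    (hσ : K.IsScope (X.move (fun t => X.pos + zigzag Q t • w) τ .opening).visited σ)
    (hangle : 0 ≤ σ.angle) :
    K.Invariant s ((X.move (fun t => X.pos + zigzag Q t • w) τ .opening).walkTo
      (X.path 0) .opening) := by
  obtain ⟨h0, hQ, hsearch, -⟩ : K.PhaseInvariant s X (.parallel w Q) := hphase ▸ h.phaseInvariant
  have hM := hsearch.isFeasible_move h.toIsFeasible hτ.1.1 (ph := .opening)
  have hback := segment_pos_subset_visited_zigzag h.time_nonneg hQ hτ.1.1 (w := w) (ph := .opening)
  have hvisited := State.visited_walkTo_of_segment_subset hM.time_nonneg hback (ph := .opening)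
  have hstart : X.path 0 = X.pos := h.path_zero.trans (h.pos_eq h0).symm
  rw [hstart]
  refine ⟨hM.walkTo (visible_iff_segment_subset_free.2 (hback.trans hM.visited_subset)),
    State.walkTo_pos.trans (h.pos_eq h0), σ, hvisited.symm ▸ hσ, hangle, Or.inr ?_⟩
  obtain hfin | ⟨σ', hσ', hle⟩ := hτ.1.2
  · exact absurd hfin hσ.not_finished
  · rwa [hσ.angle_eq hM.isPreconnected_visited hM.visited_subset hσ']

theorem chooseBisection (h : K.Invariant s X) (hσ : K.IsScope X.visited σ)
    (hangle₀ : 0 ≤ σ.angle) (hangle : σ.angle ≤ Real.pi / 2) (hw : ‖w‖ = 1)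
    (hperp : inner ℝ w (‖σ.uR‖⁻¹ • σ.uR + ‖σ.uL‖⁻¹ • σ.uL) = 0) (hβ : K.IsBrokenLine X.pos w β) :
    K.Invariant s { X with phase := .bisection β |inner ℝ w (σ.vL - σ.vR)| } := by
  have hw0 : w ≠ 0 := norm_ne_zero_iff.1 (hw ▸ one_ne_zero)
  have hpi := Real.pi_pos
  have hQ : 0 < |inner ℝ w (σ.vL - σ.vR)| :=
    abs_pos.2 (hσ.inner_vL_sub_vR_ne_zero (by linarith) hw0 hperp)
  exact ⟨h.with_phase, ⟨w, hβ.isSearch_zigzag hw0 hQ⟩,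
    not_stopAt_of_lt h.isPreconnected_visited h.visited_subset hσ (by linarith)⟩

theorem step (h : K.Invariant s X) (hstep : K.Step X Y) : K.Invariant s Y := by
  cases hstep with
  | chooseParallel σ w hphase hσ hangle hw hpar => exact h.chooseParallel hphase hσ hangle hw hpar
  | parallelReturn w Q τ σ hphase hτ hσ hangle => exact h.parallelReturn hphase hτ hσ hangle
  | parallelClose w Q τ hphase hτ =>
    obtain ⟨-, -, hsearch, hno⟩ : K.PhaseInvariant s X (.parallel w Q) := hphase ▸ h.phaseInvariant
    exact ⟨hsearch.isFeasible_move h.toIsFeasible hτ.1.1,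
      hsearch.finished_or_not_inEdgeInterior h.toIsFeasible hno hτ⟩
  | chooseBisection σ w β _ hσ hangle₀ hangle hw hperp _ hβ =>
    exact h.chooseBisection hσ hangle₀ hangle hw hperp hβ
  | bisectionClose β Q τ hphase hτ =>
    obtain ⟨⟨w, hsearch⟩, hno⟩ : K.PhaseInvariant s X (.bisection β Q) := hphase ▸ h.phaseInvariant
    exact ⟨hsearch.isFeasible_move h.toIsFeasible hτ.1.1,
      hsearch.finished_or_not_inEdgeInterior h.toIsFeasible hno hτ⟩
  | approach σ q _ _ _ hq =>
    refine ⟨h.walkTo hq.visible, Or.inr ?_⟩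
    rw [State.walkTo_pos]
    exact hq.not_inEdgeInterior

end Invariant

theorem Reaches.invariant (hs : s ∈ K.free) (h : K.Reaches s X) : K.Invariant s X := by
  induction h with
  | refl => exact invariant_init hs
  | tail _ hstep ih => exact ih.step hstep

end Invariant

section Termination

open Classical in
/-- An upper bound for the number of steps that can follow the state `X` of an execution: the search
phases take four steps, and each later step sees a new edge. -/
noncomputable def stepBound (K : ConvexPolygon) (X : State) : ℕ :=
  match X.phase with
  | .opening => if X.time = 0 then K.n + 4 else K.n + 2
  | .parallel _ _ => K.n + 3
  | .bisection _ _ => K.n + 1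
  | .closing => Finset.card {i | ¬ K.EdgeSeen X.visited i}

theorem stepBound_le_of_closing (h : X.phase = .closing) : K.stepBound X ≤ K.n := by
  simp only [stepBound, h]
  exact (Finset.card_le_univ _).trans_eq (ZMod.card K.n)

theorem stepBound_walkTo_lt {q : ℂ} (hX : K.IsFeasible s X) (hphase : X.phase = .closing)
    (hσ : K.IsScope X.visited σ) (hq : K.IsClosingTarget σ X.pos q) :
    K.stepBound (X.walkTo q .closing) < K.stepBound X := by
  obtain ⟨i, hi, hiq⟩ := hq.exists_unseen_edge hσ
  have hseen : K.EdgeSeen (X.walkTo q .closing).visited i :=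
    K.edgeSeen_iff.2 ⟨q, hX.mem_visited_walkTo hq.visible, hiq⟩
  classical
  have hphase' : (X.walkTo q .closing).phase = .closing := rfl
  simp only [stepBound, hphase, hphase']
  refine Finset.card_lt_card (Finset.ssubset_iff_of_subset ?_ |>.2 ⟨i, ?_, ?_⟩)
  · exact Finset.monotone_filter_right _ fun j _ hj hj' =>
      hj (hj'.mono (State.visited_subset_walkTo hX.time_nonneg))
  · exact Finset.mem_filter.2 ⟨Finset.mem_univ i, hi⟩
  · exact fun hmem => (Finset.mem_filter.1 hmem).2 hseen

theorem stepBound_parallelReturn_lt (h : K.Invariant s X) (hphase : X.phase = .parallel w Q)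
    (hτ : FirstTime (K.StopAt (Real.pi / 2)) X (fun t => X.pos + zigzag Q t • w) τ) :
    K.stepBound ((X.move (fun t => X.pos + zigzag Q t • w) τ .opening).walkTo
      (X.path 0) .opening) < K.stepBound X := by
  obtain ⟨-, -, hsearch, hno⟩ : K.PhaseInvariant s X (.parallel w Q) := hphase ▸ h.phaseInvariant
  have htime : 0 < ((X.move (fun t => X.pos + zigzag Q t • w) τ .opening).walkTo
      (X.path 0) .opening).time :=
    add_pos_of_pos_of_nonneg (add_pos_of_nonneg_of_pos h.time_nonneg
      (hsearch.pos_of_firstTime h.toIsFeasible hno hτ)) (norm_nonneg _)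
  have hbound : K.stepBound ((X.move (fun t => X.pos + zigzag Q t • w) τ .opening).walkTo
      (X.path 0) .opening) = K.n + 2 := if_neg htime.ne'
  rw [hbound]
  simp only [stepBound, hphase]
  lia

theorem stepBound_lt (h : K.Invariant s X) (hstep : K.Step X Y) :
    K.stepBound Y < K.stepBound X := by
  cases hstep with
  | chooseParallel σ w hphase hσ hangle =>
    simp only [stepBound, hphase, if_pos (h.time_eq_zero hphase hσ hangle)]
    lia
  | parallelReturn w Q τ σ hphase hτ => exact stepBound_parallelReturn_lt h hphase hτ
  | parallelClose w Q τ hphase =>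
    refine (stepBound_le_of_closing rfl).trans_lt ?_
    simp only [stepBound, hphase]
    lia
  | chooseBisection σ w β hphase =>
    simp only [stepBound, hphase]
    split_ifs <;> lia
  | bisectionClose β Q τ hphase =>
    refine (stepBound_le_of_closing rfl).trans_lt ?_
    simp only [stepBound, hphase]
    lia
  | approach σ q hphase _ hσ hq => exact stepBound_walkTo_lt h.toIsFeasible hphase hσ hq

end Termination

section Progress

theorem towardsCloser_or_neg (σ : K.Scope) (p w : ℂ) :
    K.TowardsCloser σ p w ∨ K.TowardsCloser σ p (-w) := by
  simp only [TowardsCloser, inner_neg_left, abs_neg, Left.nonneg_neg_iff]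
  grind

theorem exists_towardsCloser (σ : K.Scope) (p b : ℂ) :
    ∃ w, ‖w‖ = 1 ∧ cross w b = 0 ∧ K.TowardsCloser σ p w := by
  obtain ⟨w, hw, hcross⟩ := exists_norm_eq_one_cross_eq_zero b
  obtain hcloser | hcloser := towardsCloser_or_neg σ p w
  · exact ⟨w, hw, hcross, hcloser⟩
  · exact ⟨-w, by rwa [norm_neg], by rw [cross_neg_left, hcross, neg_zero], hcloser⟩

namespace Invariant

theorem exists_step_of_opening (h : K.Invariant s X) (hphase : X.phase = .opening) :
    ∃ Y, K.Step X Y := by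
  obtain ⟨-, σ, hσ, h0, -⟩ : K.PhaseInvariant s X .opening := hphase ▸ h.phaseInvariant
  obtain hangle | hangle := lt_or_ge (Real.pi / 2) σ.angle
  · obtain ⟨w, hw, hpar, hcloser⟩ := exists_towardsCloser σ X.pos (σ.vL - σ.vR)
    exact ⟨_, .chooseParallel X σ w hphase hσ hangle hw hpar hcloser⟩
  · obtain ⟨w, hw, hperp, hcloser⟩ := exists_towardsCloser σ X.pos
      (Complex.I * (‖σ.uR‖⁻¹ • σ.uR + ‖σ.uL‖⁻¹ • σ.uL))
    rw [cross_I_mul_right] at hperp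
    obtain ⟨β, hβ⟩ := exists_isBrokenLine (h.visited_subset h.pos_mem_visited) hw
    exact ⟨_, .chooseBisection X σ w β hphase hσ h0 hangle hw hperp hcloser hβ⟩

theorem exists_step_of_parallel (h : K.Invariant s X) (hphase : X.phase = .parallel w Q) :
    ∃ Y, K.Step X Y := by
  obtain ⟨-, -, hsearch, -⟩ : K.PhaseInvariant s X (.parallel w Q) := hphase ▸ h.phaseInvariant
  have hpi := Real.pi_pos
  obtain ⟨τ, hτ⟩ := hsearch.exists_firstTime h.toIsFeasible (θ := Real.pi / 2)
    ⟨by linarith, le_rfl⟩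
  obtain hfin | ⟨σ, hσ, -⟩ := hτ.1.2
  · exact ⟨_, .parallelClose X w Q τ hphase hτ (Or.inl hfin)⟩
  · obtain hangle | hangle := le_or_gt 0 σ.angle
    · exact ⟨_, .parallelReturn X w Q τ σ hphase hτ hσ hangle⟩
    · exact ⟨_, .parallelClose X w Q τ hphase hτ (Or.inr ⟨σ, hσ, hangle⟩)⟩

theorem exists_step_of_bisection (h : K.Invariant s X) (hphase : X.phase = .bisection β Q) :
    ∃ Y, K.Step X Y := by
  obtain ⟨⟨w, hsearch⟩, -⟩ : K.PhaseInvariant s X (.bisection β Q) := hphase ▸ h.phaseInvariant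
  have hpi := Real.pi_pos
  obtain ⟨τ, hτ⟩ := hsearch.exists_firstTime h.toIsFeasible (θ := -(Real.pi / 8))
    ⟨by linarith, by linarith⟩
  exact ⟨_, .bisectionClose X β Q τ hphase hτ⟩

theorem exists_step_of_closing (h : K.Invariant s X) (hphase : X.phase = .closing)
    (hfin : ¬ K.Finished X.visited) : ∃ Y, K.Step X Y := by
  have hinv : K.PhaseInvariant s X .closing := hphase ▸ h.phaseInvariant
  obtain ⟨σ, hσ⟩ := K.exists_isScope h.isCompact_visited ⟨_, h.pos_mem_visited⟩
    h.visited_subset hfin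
  obtain ⟨q, hq⟩ := hσ.exists_isClosingTarget (h.visited_subset h.pos_mem_visited)
    (hinv.resolve_left hfin)
  exact ⟨_, .approach X σ q hphase hfin hσ hq⟩

theorem exists_step (h : K.Invariant s X) (hfin : ¬ K.Finished X.visited) : ∃ Y, K.Step X Y := by
  cases hphase : X.phase with
  | opening => exact h.exists_step_of_opening hphase
  | parallel w Q => exact h.exists_step_of_parallel hphase
  | bisection β Q => exact h.exists_step_of_bisection hphase
  | closing => exact h.exists_step_of_closing hphase hfin

end Invariant

theorem Halted.finished (hX : K.Halted X) (h : K.Invariant s X) : K.Finished X.visited := by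
  by_contra hfin
  obtain ⟨Y, hstep⟩ := h.exists_step hfin
  exact hX Y hstep

end Progress

end ConvexPolygon

end ONPA

theorem mainTheorem2 (K : ONPA.ConvexPolygon) (s : ℂ) (hs : s ∈ K.free) :
    -- every execution from `s` stops after finitely many moves
    (¬ ∃ X : ℕ → ONPA.State, X 0 = ONPA.State.init s ∧ ∀ k, K.Step (X k) (X (k + 1))) ∧
    -- and then its path has finite length and is a watchman route that starts in `s`
    (∀ X : ONPA.State, K.Reaches s X → K.Halted X →
      X.route 0 = s ∧
      eVariationOn X.route (Set.Icc 0 1) < ⊤ ∧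
      K.IsWatchmanRoute X.route) := by
  refine ⟨?_, fun X hreach hhalt => ?_⟩
  · rintro ⟨X, hinit, hstep⟩
    have hinv : ∀ k, K.Invariant s (X k) := fun k => by
      induction k with
      | zero => exact hinit ▸ ONPA.ConvexPolygon.invariant_init hs
      | succ k ih => exact ih.step (hstep k)
    exact not_strictAnti_of_wellFoundedLT (fun k => K.stepBound (X k))
      (strictAnti_nat_of_succ_lt fun k => ONPA.ConvexPolygon.stepBound_lt (hinv k) (hstep k))
  · have hinv : K.Invariant s X := hreach.invariant hs
    exact ⟨hinv.route_zero, hinv.eVariationOn_route_lt_top,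
      hinv.isWatchmanRoute_route (hhalt.finished hinv)⟩
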